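/- For a bi-infinite sequence $a=(a_n)_{n\in\mathbb Z}$ of positive integers and $i\in\mathbb Z$, let $$\lambda_i(a)=[a_i;a_{i+1},a_{i+2},\dots]+[0;a_{i-1},a_{i-2},\dots],$$ where $[c_0;c_1,c_2,\dots]=c_0+\cfrac{1}{c_1+\cfrac{1}{c_2+\cdots}}$ denotes a continued fraction. Let $$L=\Big\{\limsup_{p,q\to\infty,\ p,q\in\mathbb Z}\frac{1}{|q(q\alpha-p)|}<\infty:\ \alpha\in\mathbb R\setminus\mathbb Q\Big\}$$ (where $p,q\to\infty$ means $|p|,|q|\to\infty$) be the Lagrange spectrum, and let $$M=\Big\{\frac{1}{\inf_{(x,y)\in\mathbb Z^2\setminus\{(0,0)\}}|q(x,y)|}<\infty:\ q(x,y)=ax^2+bxy+cy^2 \text{ real, indefinite, with } b^2-4ac=1\Big\}$$ be the Markov spectrum. Let $$C=\{\lambda_0(\overline{3322212}\,33^*2221233222122121212\,\theta):\ \theta\in\{1,2\}^{\mathbb N}\},$$ where the word $3322212$ is repeated infinitely often to the left, the asterisk marks the letter at position $0$, and the infinite sequence $\theta$ is appended on the right. Then: 1. $C$ is a Cantor set,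 that is, it is homeomorphic to $\{0,1\}^{\mathbb N}$. 2. $C\subset M\setminus L$. 3. $C\subset M\cap(3.70969985975024,\ 3.70969985975028)$. 4. $L\cap(3.70969985968,\ 3.70969985975033)=\emptyset$. -/

import Mathlib

open Filter Topology

/-- The Lagrange spectrum: all finite values of the upper limit of `1 / |q (q α - p)|` as the
integers `p, q` tend to infinity (in absolute value), where `α` is irrational. The upper limit is
taken in the extended reals, so that "finite" really is a condition. -/
noncomputable def lagrangeSpectrum : Set ℝ :=
  {l : ℝ | ∃ α : ℝ, Irrational α ∧
    Filter.limsup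
      (fun z : ℤ × ℤ => ((1 / |(z.2 : ℝ) * ((z.2 : ℝ) * α - (z.1 : ℝ))| : ℝ) : EReal))
      ((Filter.cofinite : Filter ℤ) ×ˢ (Filter.cofinite : Filter ℤ)) = (l : EReal)}

/-- The infimum of `|a x ^ 2 + b x y + c y ^ 2|` over the nonzero integer vectors `(x, y)`. -/
noncomputable def formInf (a b c : ℝ) : ℝ :=
  ⨅ v : {v : ℤ × ℤ // v ≠ (0, 0)},
    |a * (v.1.1 : ℝ) ^ 2 + b * (v.1.1 : ℝ) * (v.1.2 : ℝ) + c * (v.1.2 : ℝ) ^ 2|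

/-- The Markov spectrum: all finite values of `1 / inf |q(x, y)|`, where `q` is a real binary
quadratic form of discriminant `1` (in particular indefinite). The value is finite exactly when
the infimum is positive. -/
noncomputable def markovSpectrum : Set ℝ :=
  {m : ℝ | ∃ a b c : ℝ, b ^ 2 - 4 * a * c = 1 ∧ 0 < formInf a b c ∧ m = 1 / formInf a b c}

/-- The finite continued fraction `[c 0; c 1, ..., c n]`. -/
noncomputable def cfTrunc : (ℕ → ℕ) → ℕ → ℝ
  | c, 0 => (c 0 : ℝ)
  | c, n + 1 => (c 0 : ℝ) + 1 / cfTrunc (fun k => c (k + 1)) n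

/-- The infinite continued fraction `[c 0; c 1, c 2, ...]`, that is the limit of the finite ones.
The limit exists whenever `c k` is positive for all `k ≥ 1`. -/
noncomputable def cfValue (c : ℕ → ℕ) : ℝ :=
  limUnder atTop (cfTrunc c)

/-- `[a i; a (i + 1), a (i + 2), ...] + [0; a (i - 1), a (i - 2), ...]`. -/
noncomputable def lam (i : ℤ) (a : ℤ → ℕ) : ℝ :=
  cfValue (fun k => a (i + (k : ℤ))) +
    cfValue (fun k => if k = 0 then 0 else a (i - (k : ℤ)))

/-- The bi-infinite sequence `... w w w u v* θ`, where the finite word `w` is repeated infinitely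
often to the left, and the first letter of the finite word `v` sits at position `0`. -/
def leftPeriodic (w u v : List ℕ) (θ : ℕ → ℕ) : ℤ → ℕ
  | Int.ofNat n => if n < v.length then v.getD n 0 else θ (n - v.length)
  | Int.negSucc n =>
      if n < u.length then u.reverse.getD n 0
      else w.reverse.getD ((n - u.length) % w.length) 0

/-- The bi-infinite sequence with period `3322212` repeated infinitely often to the left, followed
by `33*2221233222122121212`, followed by `θ`; the asterisk marks the letter at position `0`. -/
def seqC (θ : ℕ → ℕ) : ℤ → ℕ :=
  leftPeriodic [3, 3, 2, 2, 2, 1, 2] [3]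
    [3, 2, 2, 2, 1, 2, 3, 3, 2, 2, 2, 1, 2, 2, 1, 2, 1, 2, 1, 2] θ

/-- The set of the numbers `λ_0` of the sequences `seqC θ`, where `θ` has all its terms in
`{1, 2}`. -/
noncomputable def cantorC : Set ℝ :=
  {x : ℝ | ∃ θ : ℕ → ℕ, (∀ n, θ n = 1 ∨ θ n = 2) ∧ x = lam 0 (seqC θ)}

/-! ### Continued fractions of sequences of positive integers -/

/-! Approximation and quadratic forms are translated into sequences. By Legendre's theorem, every
Lagrange value above 2 is the upper limit of λ_i(b) as i → ∞ for some sequence b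
(`exists_seq_of_mem_lagrangeSpectrum`). On the other side, λ_0(a) lies in M as soon as it is the
maximum of all λ_i(a), because reducing the associated form along the continued fraction bounds its
values below by the numbers 1/λ_i(a) (`lam_mem_markovSpectrum`).

The gap in L comes from self-replication. Let P be the periodic sequence with period 3322212. If all
λ_i near the origin are below 3.70969985975033 and λ_0 > 3.70969985968, then the letters at
positions -16 to 11 are those of P, up to reversal (`isPeriodicNear_of_lam_gt`). Such a block, among
small values of λ, forces seven more letters of P on its left (`IsPeriodicNear.extend`), and so on.
But P itself only has values at most 3.70969985968 (`lam_zero_le_of_periodic`). An upper limit in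
the gap requires infinitely many large values: a reversed block makes everything far to its right
periodic, and otherwise a late large value makes the sequence periodic around an earlier one. Both
are absurd (`false_of_lam_in_gap`).

The sequences of C escape since they have a single large value: they follow P from -∞ up to position
12 and then leave it. Their λ_0 exceeds every other λ_i, lies in the stated interval, and depends
continuously and injectively on θ, so C is an embedded copy of a compact Cantor space.

All numerical claims are finite: a word around the origin encloses λ between rationals, which are
compared by cross-multiplication of natural numbers. -/

theorem cfTrunc_ge (c : ℕ → ℕ) (hc : ∀ k, 1 ≤ c (k + 1)) (n : ℕ) : (c 0 : ℝ) ≤ cfTrunc c n := by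
  induction n generalizing c with
  | zero => simp [cfTrunc]
  | succ n ih =>
    have h := ih (fun k => c (k + 1)) (fun k => hc (k + 1))
    have h1 : (1 : ℝ) ≤ (c (0 + 1) : ℝ) := by exact_mod_cast hc 0
    have : (0 : ℝ) ≤ 1 / cfTrunc (fun k => c (k + 1)) n := by
      apply div_nonneg zero_le_one; norm_num at h h1; linarith
    simp only [cfTrunc]; linarith

theorem one_le_cfTrunc (c : ℕ → ℕ) (hc : ∀ k, 1 ≤ c k) (n : ℕ) : 1 ≤ cfTrunc c n := by
  have h := cfTrunc_ge c (fun k => hc (k + 1)) n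
  have h1 : (1 : ℝ) ≤ (c 0 : ℝ) := by exact_mod_cast hc 0
  linarith

/-- Two consecutive steps of a continued fraction expansion contract distances by a factor `4`. -/
theorem abs_sub_le_of_two_steps {a b x y : ℝ} (hb : 1 ≤ b) (hx : 1 ≤ x) (hy : 1 ≤ y) :
    |(a + 1 / (b + 1 / x)) - (a + 1 / (b + 1 / y))| ≤ |x - y| / 4 := by
  have hx0 : 0 < x := by linarith
  have hy0 : 0 < y := by linarith
  have h1 : 2 ≤ b * x + 1 := by nlinarith
  have h2 : 2 ≤ b * y + 1 := by nlinarith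
  have e : (a + 1 / (b + 1 / x)) - (a + 1 / (b + 1 / y)) =
      (x - y) / ((b * x + 1) * (b * y + 1)) := by
    have : b * x + 1 ≠ 0 := by linarith
    have : b * y + 1 ≠ 0 := by linarith
    have e1 : b + 1 / x = (b * x + 1) / x := by field_simp
    have e2 : b + 1 / y = (b * y + 1) / y := by field_simp
    rw [e1, e2]; field_simp; ring
  rw [e, abs_div]
  apply div_le_div_of_nonneg_left (abs_nonneg _) (by norm_num)
  rw [abs_of_nonneg (by positivity)]; nlinarith

theorem abs_add_inv_sub_le {a x y : ℝ} (hx : 1 ≤ x) (hy : 1 ≤ y) :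
    |(a + 1 / x) - (a + 1 / y)| ≤ 1 := by
  have h1 : 1 / x ≤ 1 := by rw [div_le_one (by linarith)]; exact hx
  have h2 : 1 / y ≤ 1 := by rw [div_le_one (by linarith)]; exact hy
  have h3 : 0 ≤ 1 / x := by positivity
  have h4 : 0 ≤ 1 / y := by positivity
  rw [abs_le]; constructor <;> linarith

/-- The induction takes two letters at a time: a single step x ↦ a + 1/x with x ≥ 1 has no uniform
contraction factor. Allowing two sequences and two lengths gives both convergence and continuity in
the letters. -/
theorem abs_cfTrunc_sub_le (n : ℕ) : ∀ (m : ℕ) (c d : ℕ → ℕ), (∀ k, 1 ≤ c (k + 1)) →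
    (∀ k, 1 ≤ d (k + 1)) → (∀ k ≤ n, c k = d k) → n ≤ m →
    |cfTrunc c n - cfTrunc d m| ≤ (1 / 4) ^ (n / 2) := by
  induction n using Nat.twoStepInduction with
  | zero =>
    intro m c d hc hd h _
    cases m with
    | zero => simp [cfTrunc, h 0 le_rfl]
    | succ m =>
      have h1 := one_le_cfTrunc (fun k => d (k + 1)) hd m
      have h2 : 1 / cfTrunc (fun k => d (k + 1)) m ≤ 1 := by
        rw [div_le_one (by linarith)]; exact h1
      have h3 : 0 ≤ 1 / cfTrunc (fun k => d (k + 1)) m := by positivity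
      simp only [cfTrunc, h 0 le_rfl, Nat.zero_div, pow_zero]
      rw [abs_le]; constructor <;> linarith
  | one =>
    intro m c d hc hd h hm
    obtain ⟨m, rfl⟩ : ∃ j, m = j + 1 := ⟨m - 1, by omega⟩
    have h1 := one_le_cfTrunc (fun k => d (k + 1)) hd m
    have h2 := one_le_cfTrunc (fun k => c (k + 1)) hc 0
    have := abs_add_inv_sub_le (a := d 0) h2 h1
    have e : c 0 = d 0 := h 0 (by omega)
    simpa [cfTrunc, e] using this
  | more n ih _ =>
    intro m c d hc hd h hm
    obtain ⟨m, rfl⟩ : ∃ j, m = j + 2 := ⟨m - 2, by omega⟩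
    have h1 := one_le_cfTrunc (fun k => d (k + 2)) (fun k => hd (k + 1)) m
    have h2 := one_le_cfTrunc (fun k => c (k + 2)) (fun k => hc (k + 1)) n
    have e0 : c 0 = d 0 := h 0 (by omega)
    have e1 : c 1 = d 1 := h 1 (by omega)
    have hb : (1 : ℝ) ≤ (d 1 : ℝ) := by exact_mod_cast hd 0
    have h3 := ih m (fun k => c (k + 2)) (fun k => d (k + 2)) (fun k => hc (k + 2))
      (fun k => hd (k + 2)) (fun k hk => h (k + 2) (by omega)) (by omega)
    have h4 := abs_sub_le_of_two_steps (a := d 0) hb h2 h1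
    have e5 : (n + 2) / 2 = n / 2 + 1 := by omega
    simp only [cfTrunc, zero_add, e0, e1, add_assoc, Nat.reduceAdd] at h4 h3 ⊢
    rw [e5, pow_succ]
    linarith

theorem tendsto_quarter_pow : Tendsto (fun n : ℕ => ((1 : ℝ) / 4) ^ (n / 2)) atTop (𝓝 0) := by
  have h := tendsto_pow_atTop_nhds_zero_of_lt_one (r := (1 : ℝ) / 4) (by norm_num) (by norm_num)
  exact h.comp (Nat.tendsto_div_const_atTop (by norm_num))

theorem tendsto_cfTrunc (c : ℕ → ℕ) (hc : ∀ k, 1 ≤ c (k + 1)) :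
    Tendsto (cfTrunc c) atTop (𝓝 (cfValue c)) := by
  have h : CauchySeq (cfTrunc c) :=
    cauchySeq_of_le_tendsto_0' _ (fun n m hnm => by
      rw [Real.dist_eq]
      exact abs_cfTrunc_sub_le n m c c hc hc (fun _ _ => rfl) hnm) tendsto_quarter_pow
  exact tendsto_nhds_limUnder (cauchySeq_tendsto_of_complete h)

theorem le_cfValue (c : ℕ → ℕ) (hc : ∀ k, 1 ≤ c (k + 1)) : (c 0 : ℝ) ≤ cfValue c :=
  ge_of_tendsto' (tendsto_cfTrunc c hc) (cfTrunc_ge c hc)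

theorem one_le_cfValue (c : ℕ → ℕ) (hc : ∀ k, 1 ≤ c k) : 1 ≤ cfValue c :=
  ge_of_tendsto' (tendsto_cfTrunc c fun k => hc (k + 1)) (one_le_cfTrunc c hc)

theorem cfValue_succ (c : ℕ → ℕ) (hc : ∀ k, 1 ≤ c (k + 1)) :
    cfValue c = c 0 + 1 / cfValue (fun k => c (k + 1)) := by
  have h1 := one_le_cfValue (fun k => c (k + 1)) hc
  have h2 := tendsto_cfTrunc (fun k => c (k + 1)) (fun k => hc (k + 1))
  have h3 := (tendsto_cfTrunc c hc).comp (tendsto_add_atTop_nat 1)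
  have h4 : Tendsto (fun n => (c 0 : ℝ) + 1 / cfTrunc (fun k => c (k + 1)) n) atTop
      (𝓝 (c 0 + 1 / cfValue (fun k => c (k + 1)))) :=
    tendsto_const_nhds.add (tendsto_const_nhds.div h2 (by linarith))
  exact tendsto_nhds_unique h3 h4

theorem one_lt_cfValue (c : ℕ → ℕ) (hc : ∀ k, 1 ≤ c k) : 1 < cfValue c := by
  rw [cfValue_succ c fun k => hc (k + 1)]
  have h1 := one_le_cfValue (fun k => c (k + 1)) (fun k => hc (k + 1))
  have h2 : (1 : ℝ) ≤ (c 0 : ℝ) := by exact_mod_cast hc 0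
  have : 0 < 1 / cfValue (fun k => c (k + 1)) := by positivity
  linarith

theorem abs_cfValue_sub_le (n : ℕ) (c d : ℕ → ℕ) (hc : ∀ k, 1 ≤ c (k + 1))
    (hd : ∀ k, 1 ≤ d (k + 1)) (h : ∀ k ≤ n, c k = d k) :
    |cfValue c - cfValue d| ≤ 2 * (1 / 4) ^ (n / 2) := by
  have key : ∀ e : ℕ → ℕ, (∀ k, 1 ≤ e (k + 1)) → (∀ k ≤ n, c k = e k) →
      |cfTrunc c n - cfValue e| ≤ (1 / 4) ^ (n / 2) := fun e he hce =>
    le_of_tendsto ((tendsto_const_nhds.sub (tendsto_cfTrunc e he)).abs)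
      (eventually_atTop.2 ⟨n, fun m hm => abs_cfTrunc_sub_le n m c e hc he hce hm⟩)
  have h1 := abs_le.1 (key c hc fun _ _ => rfl)
  have h2 := abs_le.1 (key d hd h)
  rw [abs_le]; constructor <;> linarith

/-- The complete quotients determine the value of the continued fraction. -/
theorem cfValue_eq_of_recurrence (c : ℕ → ℕ) (hc : ∀ k, 1 ≤ c (k + 1)) (x : ℕ → ℝ)
    (hx : ∀ k, x k = c k + 1 / x (k + 1)) (h1 : ∀ k, 1 ≤ x (k + 1)) : cfValue c = x 0 := by
  -- The bound has to be uniform in j, since each use of the contraction passes from j to j + 2.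
  have key : ∀ n : ℕ, ∀ j, |x j - cfValue (fun k => c (k + j))| ≤ (1 / 4 : ℝ) ^ n := by
    intro n
    induction n with
    | zero =>
      intro j
      have := abs_add_inv_sub_le (a := c j) (h1 j)
        (one_le_cfValue (fun k => c (k + 1 + j)) (fun k => by
          have := hc (k + j); rwa [show k + j + 1 = k + 1 + j by ring] at this))
      rw [hx j, cfValue_succ (fun k => c (k + j)) (fun k => by
        have := hc (k + j); rwa [show k + j + 1 = k + 1 + j by ring] at this)]
      simpa using this
    | succ n ih =>
      intro j
      have hc' : ∀ i k, 1 ≤ c (k + 1 + i) := fun i k => by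
        have := hc (k + i); rwa [show k + i + 1 = k + 1 + i by ring] at this
      have e1 : cfValue (fun k => c (k + j)) = c j + 1 / (c (j + 1) + 1 /
          cfValue (fun k => c (k + (j + 2)))) := by
        rw [cfValue_succ (fun k => c (k + j)) (hc' j), cfValue_succ (fun k => c (k + 1 + j))
          (fun k => hc' (j) (k + 1))]
        simp only [zero_add]
        rw [show (fun k => c (k + 1 + 1 + j)) = fun k => c (k + (j + 2)) from
          funext fun k => by congr 1; ring, show 1 + j = j + 1 by ring]
      have e2 : x j = c j + 1 / (c (j + 1) + 1 / x (j + 2)) := by rw [← hx (j + 1), ← hx j]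
      have hb : (1 : ℝ) ≤ (c (j + 1) : ℝ) := by exact_mod_cast hc j
      have := abs_sub_le_of_two_steps (a := c j) hb (h1 (j + 1))
        (one_le_cfValue (fun k => c (k + (j + 2))) (fun k => hc (k + (j + 1))))
      rw [e1, e2, pow_succ]
      have h3 := ih (j + 2)
      linarith
  have h2 := ge_of_tendsto' (tendsto_pow_atTop_nhds_zero_of_lt_one (r := (1 : ℝ) / 4)
    (by norm_num) (by norm_num)) (fun n => key n 0)
  have h3 := abs_nonpos_iff.1 h2
  simp only [add_zero] at h3
  linarith

/-- The tail exceeds 1 strictly, so the first letter is the floor of the value; removing it, the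
argument repeats. -/
theorem cfValue_injective : ∀ (c d : ℕ → ℕ), (∀ k, 1 ≤ c k) → (∀ k, 1 ≤ d k) →
    cfValue c = cfValue d → c = d := by
  have step : ∀ (c d : ℕ → ℕ), (∀ k, 1 ≤ c k) → (∀ k, 1 ≤ d k) → cfValue c = cfValue d →
      c 0 = d 0 ∧ cfValue (fun k => c (k + 1)) = cfValue (fun k => d (k + 1)) := by
    intro c d hc hd h
    have hfl : ∀ e : ℕ → ℕ, (∀ k, 1 ≤ e k) → ⌊cfValue e⌋₊ = e 0 := by
      intro e he
      have h1 := one_lt_cfValue (fun k => e (k + 1)) (fun k => he (k + 1))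
      rw [cfValue_succ e fun k => he (k + 1), add_comm, Nat.floor_add_natCast (by positivity),
        Nat.floor_eq_zero.2, zero_add]
      rw [div_lt_one (by linarith)]; exact h1
    have h0 : c 0 = d 0 := by rw [← hfl c hc, ← hfl d hd, h]
    refine ⟨h0, ?_⟩
    rw [cfValue_succ c fun k => hc (k + 1), cfValue_succ d fun k => hd (k + 1), h0] at h
    have h2 := add_left_cancel h
    rw [one_div, one_div] at h2
    exact inv_injective h2
  intro c d hc hd h
  funext n
  have : ∀ n, cfValue (fun k => c (k + n)) = cfValue (fun k => d (k + n)) := by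
    intro n
    induction n with
    | zero => exact h
    | succ n ih =>
      have := (step _ _ (fun k => hc (k + n)) (fun k => hd (k + n)) ih).2
      simpa only [add_assoc, add_comm 1 n] using this
  simpa using (step _ _ (fun k => hc (k + n)) (fun k => hd (k + n)) (this n)).1

/-! ### Sequences indexed by the integers -/

theorem lam_eq (a : ℤ → ℕ) (ha : ∀ i, 1 ≤ a i) (i : ℤ) :
    lam i a = cfValue (fun k => a (i + k)) + 1 / cfValue (fun k => a (i - 1 - k)) := by
  rw [lam, cfValue_succ (fun k => if k = 0 then 0 else a (i - (k : ℤ)))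
    (fun k => by simpa using ha _)]
  simp only [Nat.add_eq_zero_iff, one_ne_zero, and_false, if_false, if_true, Nat.cast_zero, zero_add]
  congr 3
  funext k
  congr 1
  push_cast; ring

theorem lam_eq_add (a : ℤ → ℕ) (ha : ∀ i, 1 ≤ a i) (i : ℤ) :
    lam i a = a i + 1 / cfValue (fun k => a (i + 1 + k)) + 1 / cfValue (fun k => a (i - 1 - k)) := by
  rw [lam_eq a ha, cfValue_succ (fun k => a (i + k)) (fun k => ha _)]
  simp only [Nat.cast_zero, add_zero]
  congr 4
  funext k
  congr 1
  push_cast; ring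

/-- Reflection exchanges the two continued fractions in λ. It lets one-sided arguments serve in both
directions. -/
theorem lam_reverse (a : ℤ → ℕ) (ha : ∀ i, 1 ≤ a i) (n i : ℤ) :
    lam i (fun j => a (n - j)) = lam (n - i) a := by
  rw [lam_eq_add _ (fun j => ha _), lam_eq_add a ha, add_right_comm]
  have e1 : (fun k : ℕ => a (n - (i - 1 - k))) = fun k : ℕ => a (n - i + 1 + k) :=
    funext fun k => by congr 1; ring
  have e2 : (fun k : ℕ => a (n - (i + 1 + k))) = fun k : ℕ => a (n - i - 1 - k) :=
    funext fun k => by congr 1; ring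
  rw [e1, e2]

theorem lam_shift (a : ℤ → ℕ) (n i : ℤ) : lam i (fun j => a (n + j)) = lam (n + i) a := by
  simp only [lam, add_assoc, add_sub_assoc]

/-! ### Interval bounds from finitely many letters -/

/-- The sequence `c` of positive integers begins with the word `w`, and the three letters that
follow `w` are at most `3`. -/
def Fits : List ℕ → (ℕ → ℕ) → Prop
  | [], c => (∀ k, 1 ≤ c k) ∧ c 0 ≤ 3 ∧ c 1 ≤ 3 ∧ c 2 ≤ 3
  | x :: w, c => c 0 = x ∧ 1 ≤ x ∧ Fits w (fun k => c (k + 1))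

theorem Fits.pos : ∀ {w : List ℕ} {c : ℕ → ℕ}, Fits w c → ∀ k, 1 ≤ c k
  | [], _, h, k => h.1 k
  | _ :: _, _, h, 0 => by rw [h.1]; exact h.2.1
  | _ :: _, _, h, k + 1 => Fits.pos h.2.2 k

theorem fits_of_getD : ∀ (w : List ℕ) (c : ℕ → ℕ), (∀ k, 1 ≤ c k) →
    (∀ k < w.length, c k = w.getD k 0) → (∀ k < 3, c (w.length + k) ≤ 3) → Fits w c
  | [], c, hp, _, h3 => by
    simp only [List.length_nil, zero_add] at h3
    exact ⟨hp, h3 0 (by norm_num), h3 1 (by norm_num), h3 2 (by norm_num)⟩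
  | x :: w, c, hp, h, h3 => by
    have h0 : c 0 = x := h 0 (by simp)
    refine ⟨h0, h0 ▸ hp 0, fits_of_getD w _ (fun _ => hp _) (fun k hk => ?_) fun k hk => ?_⟩
    · simpa using h (k + 1) (by simpa using hk)
    · have := h3 k hk
      rwa [List.length_cons, add_right_comm] at this

theorem Fits.getD : ∀ {w : List ℕ} {c : ℕ → ℕ}, Fits w c → ∀ k < w.length, c k = w.getD k 0
  | [], _, _, _, hk => by simp at hk
  | _ :: _, _, h, 0, _ => h.1
  | _ :: _, _, h, k + 1, hk => by
    simpa using Fits.getD h.2.2 k (by simpa using hk)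

theorem Fits.append : ∀ {w : List ℕ} {c : ℕ → ℕ} {x : ℕ}, Fits w c → c w.length = x →
    c (w.length + 3) ≤ 3 → Fits (w ++ [x]) c
  | [], _, _, h, hx, h3 => ⟨hx, hx ▸ h.1 0, fun _ => h.1 _, h.2.2.1, h.2.2.2, h3⟩
  | _ :: _, _, _, h, hx, h3 => ⟨h.1, h.2.1, Fits.append h.2.2 hx h3⟩

theorem Fits.le_three : ∀ {w : List ℕ} {c : ℕ → ℕ}, Fits w c → c w.length ≤ 3
  | [], _, h => h.2.1
  | _ :: w, _, h => Fits.le_three (w := w) h.2.2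

/-- Quadruple `(a, b, p, q)` with `a / b ≤ [0; w, ...] ≤ p / q`. -/
def enclose : List ℕ → ℕ × ℕ × ℕ × ℕ
  | [] => (5, 19, 4, 5)
  | x :: w => match enclose w with
    | (a, b, p, q) => (q, x * q + p, b, x * b + a)

/-- `I = (a, b, p, q)` describes an interval `[a / b, p / q]` that contains `t`. -/
def Encloses (I : ℕ × ℕ × ℕ × ℕ) (t : ℝ) : Prop :=
  0 < I.2.1 ∧ 0 < I.2.2.2 ∧ (I.1 : ℝ) / I.2.1 ≤ t ∧ t ≤ (I.2.2.1 : ℝ) / I.2.2.2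

/-- A first letter at most 3 gives a value at most 4; hence one step earlier the value is at least 1
+ 1/4, and two steps earlier at most 3 + 4/5. This uses exactly three bounded letters, and the
inverses 5/19 and 4/5 start `enclose`. -/
theorem cfValue_mem_of_le_three {c : ℕ → ℕ} (hp : ∀ k, 1 ≤ c k) (h0 : c 0 ≤ 3) (h1 : c 1 ≤ 3)
    (h2 : c 2 ≤ 3) : 5 / 4 ≤ cfValue c ∧ cfValue c ≤ 19 / 5 := by
  have key : ∀ d : ℕ → ℕ, (∀ k, 1 ≤ d k) → d 0 ≤ 3 → cfValue d ≤ 4 := fun d hd hd3 => by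
    rw [cfValue_succ d fun k => hd (k + 1)]
    have h := one_le_cfValue (fun k => d (k + 1)) fun k => hd (k + 1)
    have h' : 1 / cfValue (fun k => d (k + 1)) ≤ 1 := by rw [div_le_one (by linarith)]; exact h
    have : (d 0 : ℝ) ≤ 3 := by exact_mod_cast hd3
    linarith
  have key' : ∀ d : ℕ → ℕ, (∀ k, 1 ≤ d k) → d 1 ≤ 3 → 5 / 4 ≤ cfValue d := fun d hd hd3 => by
    rw [cfValue_succ d fun k => hd (k + 1)]
    have h := one_le_cfValue (fun k => d (k + 1)) fun k => hd (k + 1)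
    have h' : 1 / 4 ≤ 1 / cfValue (fun k => d (k + 1)) :=
      one_div_le_one_div_of_le (by linarith) (key _ (fun k => hd (k + 1)) hd3)
    have : (1 : ℝ) ≤ d 0 := by exact_mod_cast hd 0
    linarith
  refine ⟨key' c hp h1, ?_⟩
  rw [cfValue_succ c fun k => hp (k + 1)]
  have h := key' (fun k => c (k + 1)) (fun k => hp (k + 1)) h2
  have h' : 1 / cfValue (fun k => c (k + 1)) ≤ 1 / (5 / 4) :=
    one_div_le_one_div_of_le (by norm_num) h
  have : (c 0 : ℝ) ≤ 3 := by exact_mod_cast h0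
  linarith

/-- The map t ↦ 1/(x + t) is decreasing, so every letter exchanges the roles of the two end points.
-/
theorem enclose_sound : ∀ {w : List ℕ} {c : ℕ → ℕ}, Fits w c →
    Encloses (enclose w) (1 / cfValue c)
  | [], c, h => by
    have h1 := cfValue_mem_of_le_three h.1 h.2.1 h.2.2.1 h.2.2.2
    refine ⟨by norm_num [enclose], by norm_num [enclose], ?_, ?_⟩
    · rw [enclose, div_le_div_iff₀ (by norm_num) (by linarith)]; norm_num; linarith
    · rw [enclose, div_le_div_iff₀ (by linarith) (by norm_num)]; norm_num; linarith
  | x :: w, c, h => by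
    obtain ⟨hb, hq, h1, h2⟩ := enclose_sound h.2.2
    rw [cfValue_succ c fun k => h.pos (k + 1), h.1]
    set t := 1 / cfValue (fun k => c (k + 1))
    rcases hw : enclose w with ⟨a, b, p, q⟩
    simp only [hw] at hb hq h1 h2
    have hx : (1 : ℝ) ≤ x := by exact_mod_cast h.2.1
    have hb' : (0 : ℝ) < b := by exact_mod_cast hb
    have hq' : (0 : ℝ) < q := by exact_mod_cast hq
    have ht : 0 ≤ t := le_trans (by positivity) h1
    rw [div_le_iff₀ hb'] at h1
    rw [le_div_iff₀ hq'] at h2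
    have hx1 := h.2.1
    refine ⟨?_, ?_, ?_, ?_⟩ <;> simp only [enclose, hw] <;> push_cast
    · positivity
    · positivity
    · rw [div_le_div_iff₀ (by positivity) (by linarith)]; nlinarith
    · rw [div_le_div_iff₀ (by linarith) (by positivity)]; nlinarith

/-- `n / d ≤ x + s + t` for all `s` and `t` enclosed by `I` and `J`. -/
def sumGe (n d x : ℕ) : ℕ × ℕ × ℕ × ℕ → ℕ × ℕ × ℕ × ℕ → Bool
  | (a, b, _, _), (a', b', _, _) =>
    Nat.ble (n * (b * b')) ((x * (b * b') + a * b' + a' * b) * d)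

/-- `x + s + t ≤ n / d` for all `s` and `t` enclosed by `I` and `J`. -/
def sumLe (n d x : ℕ) : ℕ × ℕ × ℕ × ℕ → ℕ × ℕ × ℕ × ℕ → Bool
  | (_, _, p, q), (_, _, p', q') =>
    Nat.ble ((x * (q * q') + p * q' + p' * q) * d) (n * (q * q'))

theorem le_of_sumGe {n d x : ℕ} {I J : ℕ × ℕ × ℕ × ℕ} {s t : ℝ} (hd : 0 < d) (hI : Encloses I s)
    (hJ : Encloses J t) (h : sumGe n d x I J = true) : (n : ℝ) / d ≤ x + s + t := by
  obtain ⟨a, b, p, q⟩ := I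
  obtain ⟨a', b', p', q'⟩ := J
  obtain ⟨hb, -, h1, -⟩ := hI
  obtain ⟨hb', -, h1', -⟩ := hJ
  simp only at hb hb' h1 h1'
  have h2 := Nat.le_of_ble_eq_true h
  have h3 : (n : ℝ) * (b * b') ≤ ((x * (b * b') + a * b' + a' * b) * d) := by exact_mod_cast h2
  have hb0 : (0 : ℝ) < b := by exact_mod_cast hb
  have hb0' : (0 : ℝ) < b' := by exact_mod_cast hb'
  have hd0 : (0 : ℝ) < d := by exact_mod_cast hd
  have h4 : (n : ℝ) / d ≤ x + a / b + a' / b' := by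
    rw [div_le_iff₀ hd0]
    have : ((x : ℝ) + a / b + a' / b') * d = ((x * (b * b') + a * b' + a' * b) * d) / (b * b') := by
      field_simp
    rw [this, le_div_iff₀ (by positivity)]; exact h3
  linarith

theorem le_of_sumLe {n d x : ℕ} {I J : ℕ × ℕ × ℕ × ℕ} {s t : ℝ} (hd : 0 < d) (hI : Encloses I s)
    (hJ : Encloses J t) (h : sumLe n d x I J = true) : x + s + t ≤ (n : ℝ) / d := by
  obtain ⟨a, b, p, q⟩ := I
  obtain ⟨a', b', p', q'⟩ := J
  obtain ⟨-, hb, -, h1⟩ := hI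
  obtain ⟨-, hb', -, h1'⟩ := hJ
  simp only at hb hb' h1 h1'
  have h2 := Nat.le_of_ble_eq_true h
  have h3 : ((x * (q * q') + p * q' + p' * q) * d) ≤ (n : ℝ) * (q * q') := by exact_mod_cast h2
  have hb0 : (0 : ℝ) < q := by exact_mod_cast hb
  have hb0' : (0 : ℝ) < q' := by exact_mod_cast hb'
  have hd0 : (0 : ℝ) < d := by exact_mod_cast hd
  have h4 : x + p / q + p' / q' ≤ (n : ℝ) / d := by
    rw [le_div_iff₀ hd0]
    have : ((x : ℝ) + p / q + p' / q') * d = ((x * (q * q') + p * q' + p' * q) * d) / (q * q') := by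
      field_simp
    rw [this, div_le_iff₀ (by positivity)]; exact h3
  linarith

/-- The letters `a 0, a 1, ...`. -/
def rightPart (a : ℤ → ℕ) : ℕ → ℕ := fun k => a k

/-- The letters `a (-1), a (-2), ...`. -/
def leftPart (a : ℤ → ℕ) : ℕ → ℕ := fun k => a (-1 - k)

theorem lam_zero_eq {a : ℤ → ℕ} {r : List ℕ} {x : ℕ} (ha : ∀ i, 1 ≤ a i)
    (hr : Fits (x :: r) (rightPart a)) :
    lam 0 a = x + 1 / cfValue (leftPart a) + 1 / cfValue (fun k => rightPart a (k + 1)) := by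
  have hx : a 0 = x := hr.1
  rw [lam_eq_add a ha, hx, add_right_comm]
  have e1 : (fun k : ℕ => a (0 - 1 - k)) = leftPart a := by simp [leftPart, funext_iff]
  have e2 : (fun k : ℕ => a (0 + 1 + k)) = fun k => rightPart a (k + 1) :=
    funext fun k => by simp only [rightPart]; congr 1; push_cast; ring
  rw [e1, e2]

theorem le_lam_zero {a : ℤ → ℕ} {l r : List ℕ} {x n d : ℕ} (hd : 0 < d) (ha : ∀ i, 1 ≤ a i)
    (hl : Fits l (leftPart a)) (hr : Fits (x :: r) (rightPart a))
    (h : sumGe n d x (enclose l) (enclose r) = true) : (n : ℝ) / d ≤ lam 0 a := by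
  rw [lam_zero_eq ha hr]
  exact le_of_sumGe hd (enclose_sound hl) (enclose_sound hr.2.2) h

theorem lam_zero_le {a : ℤ → ℕ} {l r : List ℕ} {x n d : ℕ} (hd : 0 < d) (ha : ∀ i, 1 ≤ a i)
    (hl : Fits l (leftPart a)) (hr : Fits (x :: r) (rightPart a))
    (h : sumLe n d x (enclose l) (enclose r) = true) : lam 0 a ≤ (n : ℝ) / d := by
  rw [lam_zero_eq ha hr]
  exact le_of_sumLe hd (enclose_sound hl) (enclose_sound hr.2.2) h

/-- Moving the origin one step to the right. -/
theorem Fits.shift {a : ℤ → ℕ} {l r : List ℕ} {x : ℕ} (hl : Fits l (leftPart a))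
    (hr : Fits (x :: r) (rightPart a)) :
    Fits (x :: l) (leftPart fun j => a (1 + j)) ∧ Fits r (rightPart fun j => a (1 + j)) := by
  constructor
  · refine ⟨by simpa [leftPart, rightPart] using hr.1, hr.2.1, ?_⟩
    convert hl using 1
    funext k; simp only [leftPart]; congr 1; push_cast; ring
  · convert hr.2.2 using 1
    funext k; simp only [rightPart]; congr 1; push_cast; ring

/-- Some letter `3` of `r` has `λ ≥ n / d`, when `r` is preceded by the reverse of `l`. -/
def forbidden (n d : ℕ) : List ℕ → List ℕ → Bool
  | _, [] => false
  | l, x :: r => (Nat.beq x 3 && sumGe n d x (enclose l) (enclose r)) || forbidden n d (x :: l) r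

theorem forbidden_sound {n d : ℕ} (hd : 0 < d) : ∀ (r l : List ℕ) (a : ℤ → ℕ), (∀ i, 1 ≤ a i) →
    Fits l (leftPart a) → Fits r (rightPart a) → forbidden n d l r = true →
    ∃ i : ℕ, i < r.length ∧ (n : ℝ) / d ≤ lam i a
  | [], _, _, _, _, _, h => by simp [forbidden] at h
  | x :: r, l, a, ha, hl, hr, h => by
    rw [forbidden, Bool.or_eq_true, Bool.and_eq_true] at h
    -- Testing only letters 3 saves work and plays no part in soundness: a letter 2 gives at most 2
    -- + 4/5 + 4/5, below the threshold used.
    rcases h with ⟨-, h⟩ | h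
    · exact ⟨0, by simp, le_lam_zero hd ha hl hr h⟩
    · obtain ⟨hl', hr'⟩ := hl.shift hr
      obtain ⟨i, hi, h'⟩ := forbidden_sound hd r (x :: l) _ (fun j => ha _) hl' hr' h
      refine ⟨i + 1, by simpa using hi, ?_⟩
      rw [lam_shift] at h'
      rwa [show ((i + 1 : ℕ) : ℤ) = 1 + i by push_cast; ring]

/-- The first `m` letters of `r` have `λ ≤ n / d`, when `r` is preceded by the reverse of `l`. -/
def allLe (n d : ℕ) : ℕ → List ℕ → List ℕ → Bool
  | 0, _, _ => true
  | _ + 1, _, [] => false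
  | m + 1, l, x :: r => sumLe n d x (enclose l) (enclose r) && allLe n d m (x :: l) r

theorem allLe_sound {n d : ℕ} (hd : 0 < d) : ∀ (m : ℕ) (r l : List ℕ) (a : ℤ → ℕ),
    (∀ i, 1 ≤ a i) → Fits l (leftPart a) → Fits r (rightPart a) → allLe n d m l r = true →
    ∀ i < m, lam (i : ℕ) a ≤ (n : ℝ) / d
  | 0, _, _, _, _, _, _, _, i, hi => by omega
  | _ + 1, [], _, _, _, _, _, h, _, _ => by simp [allLe] at h
  | m + 1, x :: r, l, a, ha, hl, hr, h, i, hi => by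
    rw [allLe, Bool.and_eq_true] at h
    cases i with
    | zero => exact lam_zero_le hd ha hl hr h.1
    | succ i =>
      obtain ⟨hl', hr'⟩ := hl.shift hr
      have h' := allLe_sound hd m r (x :: l) _ (fun j => ha _) hl' hr' h.2 i (by omega)
      rw [lam_shift] at h'
      rwa [show ((i + 1 : ℕ) : ℤ) = 1 + i by push_cast; ring]

/-! ### Exhaustive search through the surroundings of the origin -/

/-- The value of `λ` at the origin is small, when the word `r` starts there and the reverse of `l`
precedes it. -/
def lowAtZero : List ℕ → List ℕ → Bool
  | _, [] => false
  | l, x :: r => sumLe 370969985968 100000000000 x (enclose l) (enclose r)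

theorem lowAtZero_sound {a : ℤ → ℕ} (ha : ∀ i, 1 ≤ a i) : ∀ {l r : List ℕ},
    Fits l (leftPart a) → Fits r (rightPart a) → lowAtZero l r = true → lam 0 a ≤ 3.70969985968
  | _, [], _, _, h => by simp [lowAtZero] at h
  | _, _ :: _, hl, hr, h => by
    have := lam_zero_le (by norm_num) ha hl hr h
    norm_num at this ⊢; exact this

/-- The search extends the word `l` to the left of the origin (written leftwards) and the word `r`
to its right until the pair is forbidden, or has too small a value at the origin (if `useLow`), or
satisfies `goal`. It succeeds if every branch ends in this way. -/
def search (useLow : Bool) (goRight : ℕ → ℕ → Bool) (goal : List ℕ → List ℕ → Bool) :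
    ℕ → List ℕ → List ℕ → Bool
  | 0, _, _ => false
  | f + 1, l, r =>
    goal l r || forbidden 370969985975033 100000000000000 l r ||
    forbidden 370969985975033 100000000000000 r l ||
    (useLow && lowAtZero l r) ||
    (Nat.ble (l.length + r.length) 34 &&
      (if goRight l.length r.length then
        search useLow goRight goal f l (r ++ [1]) && search useLow goRight goal f l (r ++ [2]) &&
          search useLow goRight goal f l (r ++ [3])
      else
        search useLow goRight goal f (l ++ [1]) r && search useLow goRight goal f (l ++ [2]) r &&
          search useLow goRight goal f (l ++ [3]) r))

/-- All values of `λ` in a large window around the origin are small. -/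
def SmallNearZero (a : ℤ → ℕ) : Prop :=
  ∀ i : ℤ, -40 ≤ i → i ≤ 40 → lam i a < 3.70969985975033

theorem le_three_of_lam_lt {a : ℤ → ℕ} (ha : ∀ i, 1 ≤ a i) {i : ℤ} (h : lam i a < 4) :
    a i ≤ 3 := by
  rw [lam_eq_add a ha] at h
  have h1 := one_le_cfValue (fun k => a (i + 1 + k)) fun k => ha _
  have h2 := one_le_cfValue (fun k => a (i - 1 - k)) fun k => ha _
  have h3 : 0 < 1 / cfValue (fun k => a (i + 1 + k)) := by positivity
  have h4 : 0 < 1 / cfValue (fun k => a (i - 1 - k)) := by positivity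
  have h5 : (a i : ℝ) < (4 : ℕ) := by push_cast; linarith
  have := Nat.cast_lt.1 h5
  omega

theorem SmallNearZero.le_three {a : ℤ → ℕ} (h : SmallNearZero a) (ha : ∀ i, 1 ≤ a i) {i : ℤ}
    (h1 : -40 ≤ i) (h2 : i ≤ 40) : a i ≤ 3 :=
  le_three_of_lam_lt ha ((h i h1 h2).trans (by norm_num))

/-- At most 35 letters are ever fixed, so they and the three letters beyond each end stay in the
window of `SmallNearZero`. There letters are at most 3, hence three branches suffice, and a
forbidden pair contradicts smallness. -/
theorem search_sound {useLow : Bool} {goRight : ℕ → ℕ → Bool} {goal : List ℕ → List ℕ → Bool}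
    {a : ℤ → ℕ} (ha : ∀ i, 1 ≤ a i) (hsmall : SmallNearZero a)
    (hlow : useLow = true → 3.70969985968 < lam 0 a) : ∀ (f : ℕ) (l r : List ℕ),
    l.length + r.length ≤ 35 → Fits l (leftPart a) → Fits r (rightPart a) →
    search useLow goRight goal f l r = true →
    ∃ l' r', goal l' r' = true ∧ Fits l' (leftPart a) ∧ Fits r' (rightPart a)
  | 0, _, _, _, _, _, h => by simp [search] at h
  | f + 1, l, r, hlen, hl, hr, h => by
    rw [search] at h
    simp only [Bool.or_eq_true, Bool.and_eq_true] at h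
    rcases h with (((h | h) | h) | h) | h
    · exact ⟨l, r, h, hl, hr⟩
    · obtain ⟨i, hi, h'⟩ := forbidden_sound (by norm_num) r l a ha hl hr h
      have := hsmall i (by omega) (by omega)
      norm_num at h' this; linarith
    -- The reflection j ↦ -1 - j exchanges the two half-lines, so the letters of `l` are tested like
    -- those of `r`.
    · have e1 : leftPart (fun j => a (-1 - j)) = rightPart a := by
        funext k; simp [leftPart, rightPart]
      obtain ⟨i, hi, h'⟩ := forbidden_sound (by norm_num) l r (fun j => a (-1 - j))
        (fun j => ha _) (by rwa [e1]) hl h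
      rw [lam_reverse a ha] at h'
      have := hsmall (-1 - i) (by omega) (by omega)
      norm_num at h' this; linarith
    · exact absurd (lowAtZero_sound ha hl hr h.2) (not_le.2 (hlow h.1))
    · obtain ⟨h1, h2⟩ := h
      have h1 := Nat.le_of_ble_eq_true h1
      split_ifs at h2
      · have h3 := hr.pos r.length
        have h4 := hr.le_three
        have h5 : rightPart a (r.length + 3) ≤ 3 := hsmall.le_three ha (by omega) (by omega)
        have key : ∀ x, rightPart a r.length = x → search useLow goRight goal f l (r ++ [x]) = true →
            ∃ l' r', goal l' r' = true ∧ Fits l' (leftPart a) ∧ Fits r' (rightPart a) :=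
          fun x hx hs => search_sound ha hsmall hlow f l (r ++ [x])
            (by rw [List.length_append, List.length_singleton]; omega) hl (hr.append hx h5) hs
        simp only [Bool.and_eq_true] at h2
        interval_cases hx : rightPart a r.length
        exacts [key 1 rfl h2.1.1, key 2 rfl h2.1.2, key 3 rfl h2.2]
      · have h3 := hl.pos l.length
        have h4 := hl.le_three
        have h5 : leftPart a (l.length + 3) ≤ 3 := hsmall.le_three ha (by omega) (by omega)
        have key : ∀ x, leftPart a l.length = x → search useLow goRight goal f (l ++ [x]) r = true →
            ∃ l' r', goal l' r' = true ∧ Fits l' (leftPart a) ∧ Fits r' (rightPart a) :=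
          fun x hx hs => search_sound ha hsmall hlow f (l ++ [x]) r
            (by rw [List.length_append, List.length_singleton]; omega) (hl.append hx h5) hr hs
        simp only [Bool.and_eq_true] at h2
        interval_cases hx : leftPart a l.length
        exacts [key 1 rfl h2.1.1, key 2 rfl h2.1.2, key 3 rfl h2.2]

/-- The periodic sequence with period `2332221`. -/
def periodicWord (i : ℤ) : ℕ := [3, 2, 2, 2, 1, 2, 3].getD (i % 7).toNat 0

/-- The words `l` and `r` begin like the periodic sequence, `m` letters to the left and `n` letters
to the right of the origin. -/
def isPeriodicWord (m n : ℕ) (l r : List ℕ) : Bool :=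
  (List.range m).all (fun k => l.getD k 0 == periodicWord (-1 - k)) &&
    (List.range n).all (fun k => r.getD k 0 == periodicWord k)

theorem periodicWord_pos (i : ℤ) : 1 ≤ periodicWord i ∧ periodicWord i ≤ 3 := by
  have key : ∀ k < 7, 1 ≤ [3, 2, 2, 2, 1, 2, 3].getD k 0 ∧ [3, 2, 2, 2, 1, 2, 3].getD k 0 ≤ 3 := by
    decide
  exact key _ (by omega)

theorem periodicWord_congr {i j : ℤ} (h : i % 7 = j % 7) : periodicWord i = periodicWord j := by
  rw [periodicWord, periodicWord, h]

/-- The sequence `a` agrees with the periodic sequence on `m` letters to the left and `n` letters to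
the right of the origin. -/
def IsPeriodicNear (m n : ℤ) (a : ℤ → ℕ) : Prop :=
  ∀ i, -m ≤ i → i < n → a i = periodicWord i

theorem isPeriodicNear_of_isPeriodicWord {m n : ℕ} {l r : List ℕ} {a : ℤ → ℕ}
    (h : isPeriodicWord m n l r = true) (hl : Fits l (leftPart a)) (hr : Fits r (rightPart a)) :
    IsPeriodicNear m n a := by
  simp only [isPeriodicWord, Bool.and_eq_true, List.all_eq_true, List.mem_range, beq_iff_eq] at h
  have key : ∀ {w : List ℕ} {c : ℕ → ℕ} {k : ℕ} {i : ℤ}, Fits w c →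
      w.getD k 0 = periodicWord i → c k = periodicWord i := by
    intro w c k i hw hk
    rw [← hk]
    apply hw.getD
    -- Beyond the end of the word `getD` returns 0, which is not a letter of the periodic sequence.
    by_contra hlt
    rw [List.getD_eq_default _ _ (not_lt.1 hlt)] at hk
    have := (periodicWord_pos i).1
    omega
  intro i h1 h2
  rcases lt_or_ge i 0 with hi | hi
  · have := key hl (h.1 (-1 - i).toNat (by omega))
    simp only [leftPart] at this
    rwa [show -1 - ((-1 - i).toNat : ℤ) = i by omega] at this
  · have := key hr (h.2 i.toNat (by omega))
    simp only [rightPart] at this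
    rwa [show (i.toNat : ℤ) = i by omega] at this

/-- The first `m` letters of the sequence `b` to the left of the origin. -/
def leftWord (b : ℤ → ℕ) (m : ℕ) : List ℕ := (List.range m).map fun k : ℕ => b (-1 - k)

/-- The first `n` letters of the sequence `b` to the right of the origin. -/
def rightWord (b : ℤ → ℕ) (n : ℕ) : List ℕ := (List.range n).map fun k : ℕ => b k

theorem fits_leftWord {a b : ℤ → ℕ} {m : ℕ} (ha : ∀ i, 1 ≤ a i)
    (h : ∀ i : ℤ, -m ≤ i → i < 0 → a i = b i) (h3 : ∀ i : ℤ, -m - 3 ≤ i → i < -m → a i ≤ 3) :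
    Fits (leftWord b m) (leftPart a) := by
  refine fits_of_getD _ _ (fun k => ha _) (fun k hk => ?_) fun k hk => ?_
  · simp only [leftWord, List.length_map, List.length_range] at hk
    simp [leftWord, leftPart, hk, h (-1 - k) (by omega) (by omega)]
  · simp only [leftWord, List.length_map, List.length_range]
    exact h3 _ (by omega) (by omega)

theorem fits_rightWord {a b : ℤ → ℕ} {n : ℕ} (ha : ∀ i, 1 ≤ a i)
    (h : ∀ i : ℤ, 0 ≤ i → i < n → a i = b i) (h3 : ∀ i : ℤ, n ≤ i → i < n + 3 → a i ≤ 3) :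
    Fits (rightWord b n) (rightPart a) := by
  refine fits_of_getD _ _ (fun k => ha _) (fun k hk => ?_) fun k hk => ?_
  · simp only [rightWord, List.length_map, List.length_range] at hk
    simp [rightWord, rightPart, hk, h k (by omega) (by omega)]
  · simp only [rightWord, List.length_map, List.length_range]
    exact h3 _ (by omega) (by omega)

/-- A large value of `λ` in a region of small values determines the surroundings up to reversal. -/
theorem isPeriodicNear_of_lam_gt {a : ℤ → ℕ} (ha : ∀ i, 1 ≤ a i) (hsmall : SmallNearZero a)
    (hlow : 3.70969985968 < lam 0 a) :
    IsPeriodicNear 16 12 a ∨ IsPeriodicNear 16 12 (fun i => a (-i)) := by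
  have h3 : ∀ i : ℤ, -40 ≤ i → i ≤ 40 → a i ≤ 3 := fun i h1 h2 => hsmall.le_three ha h1 h2
  -- The reflection i ↦ -i fixes the origin, whose letter is the head of `r`; the reversed goal
  -- therefore moves that head to the front of `l`. The words grow in a balanced way.
  obtain ⟨l, r, h, hl, hr⟩ := search_sound (useLow := true) (goRight := fun m n => Nat.ble n m)
    (goal := fun l r => isPeriodicWord 16 12 l r || isPeriodicWord 16 12 r.tail (r.headD 0 :: l))
    ha hsmall (fun _ => hlow) 40 [] [] (by simp)
    ⟨fun k => ha _, h3 _ (by norm_num) (by norm_num), h3 _ (by norm_num) (by norm_num),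
      h3 _ (by norm_num) (by norm_num)⟩
    ⟨fun k => ha _, h3 _ (by norm_num) (by norm_num), h3 _ (by norm_num) (by norm_num),
      h3 _ (by norm_num) (by norm_num)⟩ (by decide +kernel)
  rw [Bool.or_eq_true] at h
  rcases h with h | h
  · exact Or.inl (isPeriodicNear_of_isPeriodicWord h hl hr)
  · right
    cases r with
    | nil =>
      rw [List.tail_nil, isPeriodicWord, Bool.and_eq_true] at h
      exact absurd h.1 (by decide)
    | cons x r =>
      rw [List.tail_cons, List.headD_cons] at h
      obtain ⟨hl', hr'⟩ := hl.shift hr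
      refine isPeriodicNear_of_isPeriodicWord h ?_ ?_
      · convert hr' using 1
        funext k; simp only [leftPart, rightPart]; congr 1; ring
      · convert hl' using 1
        funext k; simp only [leftPart, rightPart]; congr 1; ring

/-- In a region of small values of `λ` the periodic word extends to the left. -/
theorem IsPeriodicNear.extend {a : ℤ → ℕ} (ha : ∀ i, 1 ≤ a i) (hsmall : SmallNearZero a)
    (h : IsPeriodicNear 16 12 a) : IsPeriodicNear 23 12 a := by
  -- Only the left word grows. The goal has 23 + 12 = 35 letters, the greatest length the search
  -- reaches.
  obtain ⟨l, r, h, hl, hr⟩ := search_sound (useLow := false) (goRight := fun _ _ => false)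
    (goal := isPeriodicWord 23 12) ha hsmall (by simp) 40
    (leftWord periodicWord 16) (rightWord periodicWord 12) (by simp [leftWord, rightWord])
    (fits_leftWord ha (fun i h1 h2 => h i (by simpa using h1) (by omega))
      fun i h1 h2 => hsmall.le_three ha (by push_cast at h1; omega) (by omega))
    (fits_rightWord ha (fun i h1 h2 => h i (by omega) (by simpa using h2))
      fun i h1 h2 => hsmall.le_three ha (by omega) (by push_cast at h2; omega)) (by decide +kernel)
  exact isPeriodicNear_of_isPeriodicWord h hl hr

/-- Around the origin, the values of `λ` for the periodic sequence and its shifts are small. -/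
theorem lam_zero_le_of_periodic {a : ℤ → ℕ} (ha : ∀ i, 1 ≤ a i) (d : ℤ)
    (h : ∀ i, -28 ≤ i → i ≤ 28 → a i = periodicWord (d + i)) : lam 0 a ≤ 3.70969985968 := by
  -- Only the phase modulo 7 matters. With three bounded letters beyond each end, the words fill the
  -- window from -28 to 28.
  have key : ∀ e < 7, lowAtZero (leftWord (fun i => periodicWord ((e : ℕ) + i)) 25)
      (rightWord (fun i => periodicWord ((e : ℕ) + i)) 26) = true := by decide +kernel
  have h' : ∀ i, -28 ≤ i → i ≤ 28 → a i = periodicWord ((d % 7).toNat + i) := fun i h1 h2 => by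
    rw [h i h1 h2]; exact periodicWord_congr (by omega)
  have h3 : ∀ i, -28 ≤ i → i ≤ 28 → a i ≤ 3 := fun i h1 h2 => by
    rw [h i h1 h2]; exact (periodicWord_pos _).2
  refine lowAtZero_sound ha (fits_leftWord ha (fun i h1 h2 => ?_) fun i h1 h2 => ?_)
    (fits_rightWord ha (fun i h1 h2 => ?_) fun i h1 h2 => ?_) (key (d % 7).toNat (by omega))
  all_goals push_cast at h1 h2
  · exact h' i (by omega) (by omega)
  · exact h3 i (by omega) (by omega)
  · exact h' i (by omega) (by omega)
  · exact h3 i (by omega) (by omega)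

/-- No sequence has values of `λ` below the upper end of the gap eventually, and above its lower end
infinitely often. -/
theorem false_of_lam_in_gap {b : ℤ → ℕ} (hb : ∀ i, 1 ≤ b i) {N : ℤ}
    (hsmall : ∀ i, N ≤ i → lam i b < 3.70969985975033)
    (hlow : ∀ M : ℤ, ∃ n, M ≤ n ∧ 3.70969985968 < lam n b) : False := by
  have small : ∀ n, N + 40 ≤ n → SmallNearZero (fun j => b (n + j)) := fun n hn i h1 h2 => by
    rw [lam_shift]; exact hsmall _ (by omega)
  have small' : ∀ n, N + 40 ≤ n → SmallNearZero (fun j => b (n - j)) := fun n hn i h1 h2 => by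
    rw [lam_reverse b hb]; exact hsmall _ (by omega)
  by_cases hrev : ∃ n, N + 40 ≤ n ∧ IsPeriodicNear 16 12 (fun j => b (n - j))
  · obtain ⟨n, hn, hper⟩ := hrev
    -- In the reversed sequence, extending to the left means going to the right in `b`, so nothing
    -- stops the propagation.
    have step : ∀ j : ℕ, IsPeriodicNear 16 12 (fun i => b (n + 7 * j - i)) := by
      intro j
      induction j with
      | zero => simpa using hper
      | succ j ih =>
        intro i h1 h2
        have := ih.extend (fun _ => hb _) (small' _ (by omega)) (i - 7) (by omega) (by omega)
        rw [← periodicWord_congr (i := i - 7) (j := i) (by omega), ← this]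
        simp only
        congr 1; push_cast; ring
    obtain ⟨n', hn', hl⟩ := hlow (n + 40)
    have := lam_zero_le_of_periodic (a := fun j => b (n' - j)) (fun _ => hb _) (n - n')
      fun i h1 h2 => by
        -- This number of periods puts the position `n' - i` at an index between 5 and 11 of the
        -- translated block.
        have := step ((n' - i - n + 11) / 7).toNat (n + 7 * ((n' - i - n + 11) / 7) - (n' - i))
          (by omega) (by omega)
        rw [periodicWord_congr (j := n + 7 * ((n' - i - n + 11) / 7) - (n' - i)) (by omega), ← this]
        simp only
        congr 1; omega
    rw [lam_reverse b hb, sub_zero] at this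
    linarith
  · push Not at hrev
    -- The margin 80 keeps the block centres at or beyond N + 40 while periodicity spreads back from
    -- `n'` over the 28 letters on either side of `n`.
    obtain ⟨n, hn, hl⟩ := hlow (N + 80)
    obtain ⟨n', hn', hl'⟩ := hlow (n + 40)
    have hper : IsPeriodicNear 16 12 (fun j => b (n' + j)) := by
      refine (isPeriodicNear_of_lam_gt (fun _ => hb _) (small n' (by omega)) ?_).resolve_right ?_
      · rwa [lam_shift, add_zero]
      · exact hrev n' (by omega)
    have step : ∀ j : ℕ, N + 40 ≤ n' - 7 * j → IsPeriodicNear 16 12 (fun i => b (n' - 7 * j + i)) := by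
      intro j
      induction j with
      | zero => intro _; simpa using hper
      | succ j ih =>
        intro hj i h1 h2
        have := (ih (by omega)).extend (fun _ => hb _) (small _ (by omega)) (i - 7) (by omega)
          (by omega)
        rw [← periodicWord_congr (i := i - 7) (j := i) (by omega), ← this]
        simp only
        congr 1; push_cast; ring
    have := lam_zero_le_of_periodic (a := fun j => b (n + j)) (fun _ => hb _) (n - n')
      fun i h1 h2 => by
        have := step ((n' + 11 - (n + i)) / 7).toNat (by omega)
          (n + i - n' + 7 * ((n' + 11 - (n + i)) / 7)) (by omega) (by omega)
        rw [periodicWord_congr (j := n + i - n' + 7 * ((n' + 11 - (n + i)) / 7)) (by omega), ← this]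
        simp only
        congr 1; omega
    rw [lam_shift, add_zero] at this
    linarith

/-! ### Quadratic forms with prescribed minimum -/

/-- The form attached to the roots `α` and `-γ`, normalised to discriminant `1`. -/
noncomputable def rootForm (α γ x y : ℝ) : ℝ := (x - α * y) * (x + γ * y) / (α + γ)

/-- `[a i; a (i + 1), ...]` -/
noncomputable def rightTail (a : ℤ → ℕ) (i : ℤ) : ℝ := cfValue (fun k => a (i + k))

/-- `[0; a (i - 1), a (i - 2), ...]` -/
noncomputable def leftTail (a : ℤ → ℕ) (i : ℤ) : ℝ := 1 / cfValue (fun k => a (i - 1 - k))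

theorem lam_eq_tails {a : ℤ → ℕ} (ha : ∀ i, 1 ≤ a i) (i : ℤ) :
    lam i a = rightTail a i + leftTail a i := lam_eq a ha i

theorem rightTail_pos {a : ℤ → ℕ} (ha : ∀ i, 1 ≤ a i) (i : ℤ) : 0 < rightTail a i :=
  zero_lt_one.trans_le (one_le_cfValue _ fun _ => ha _)

theorem leftTail_pos {a : ℤ → ℕ} (ha : ∀ i, 1 ≤ a i) (i : ℤ) : 0 < leftTail a i :=
  one_div_pos.2 (zero_lt_one.trans_le (one_le_cfValue _ fun _ => ha _))

theorem rightTail_succ {a : ℤ → ℕ} (ha : ∀ i, 1 ≤ a i) (i : ℤ) :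
    rightTail a i = a i + 1 / rightTail a (i + 1) := by
  rw [rightTail, cfValue_succ _ fun _ => ha _, rightTail]
  simp only [Nat.cast_zero, add_zero]
  congr 4
  funext k; congr 1; push_cast; ring

theorem leftTail_succ {a : ℤ → ℕ} (ha : ∀ i, 1 ≤ a i) (i : ℤ) :
    leftTail a (i + 1) = 1 / (a i + leftTail a i) := by
  rw [leftTail, cfValue_succ _ fun _ => ha _, leftTail]
  simp only [Nat.cast_zero, sub_zero, add_sub_cancel_right]
  congr 5
  funext k; congr 1; push_cast; ring

/-- One step of the continued fraction is a unimodular substitution, so the forms at all indices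
represent the same numbers up to sign. -/
theorem rootForm_step {a : ℤ → ℕ} (ha : ∀ i, 1 ≤ a i) (i : ℤ) (x y : ℝ) :
    rootForm (rightTail a i) (leftTail a i) x y =
      -rootForm (rightTail a (i + 1)) (leftTail a (i + 1)) y (x - a i * y) := by
  have h1 := rightTail_pos ha (i + 1)
  have h2 := leftTail_pos ha i
  have h3 : (1 : ℝ) ≤ a i := by exact_mod_cast ha i
  rw [rightTail_succ ha i, leftTail_succ ha i, rootForm, rootForm]
  set α := rightTail a (i + 1)
  set γ := leftTail a i
  have h4 : (a i : ℝ) + γ ≠ 0 := by positivity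
  have h5 : (a i : ℝ) + 1 / α + γ ≠ 0 := by positivity
  have h6 : α + 1 / (a i + γ) ≠ 0 := by positivity
  have h7 : α * (a i + γ) + 1 ≠ 0 := by positivity
  have e1 : (a i : ℝ) + 1 / α + γ = (α * (a i + γ) + 1) / α := by field_simp; ring
  have e2 : α + 1 / (a i + γ) = (α * (a i + γ) + 1) / (a i + γ) := by field_simp
  rw [e1, e2]
  field_simp
  ring

theorem rootForm_neg (α γ x y : ℝ) : rootForm α γ (-x) (-y) = rootForm α γ x y := by
  rw [rootForm, rootForm]; ring

/-- On this axis the form equals x² / λ_i. -/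
theorem le_abs_rootForm_left {a : ℤ → ℕ} (ha : ∀ i, 1 ≤ a i) {m : ℝ}
    (hm : ∀ i, m ≤ 1 / lam i a) (i : ℤ) {x : ℤ} (hx : x ≠ 0) :
    m ≤ |rootForm (rightTail a i) (leftTail a i) x 0| := by
  have h1 := rightTail_pos ha i
  have h2 := leftTail_pos ha i
  have h3 : (1 : ℝ) ≤ (x : ℝ) ^ 2 := by
    have : 0 < x ^ 2 := by positivity
    exact_mod_cast this
  refine (hm i).trans ?_
  rw [lam_eq_tails ha, rootForm, mul_zero, mul_zero, sub_zero, add_zero, ← sq, abs_div,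
    abs_of_nonneg (sq_nonneg _), abs_of_pos (by positivity)]
  gcongr

/-- The step from i - 1 to i carries the axis y = 0 to the axis x = 0. -/
theorem le_abs_rootForm_right {a : ℤ → ℕ} (ha : ∀ i, 1 ≤ a i) {m : ℝ}
    (hm : ∀ i, m ≤ 1 / lam i a) (i : ℤ) {y : ℤ} (hy : y ≠ 0) :
    m ≤ |rootForm (rightTail a i) (leftTail a i) 0 y| := by
  have h := le_abs_rootForm_left ha hm (i - 1) hy
  rw [rootForm_step ha, abs_neg] at h
  simpa using h

/-- A concave function on an interval is bounded below by its values at the end points. -/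
theorem le_of_concave_combination {m u v w x z : ℝ} (hx : 0 < x) (hxz : x < z) (hu : m ≤ u)
    (hv : m ≤ v) (h : (z - x) * u + x * v ≤ z * w) : m ≤ w := by
  have h1 : (z - x) * m + x * m ≤ z * w := by
    have := mul_le_mul_of_nonneg_left hu (sub_nonneg.2 hxz.le)
    have := mul_le_mul_of_nonneg_left hv hx.le
    linarith
  have h2 : z * m ≤ z * w := by linarith
  exact le_of_mul_le_mul_left h2 (hx.trans hxz)

/-- Descent on |x| + |y|, with y > 0 by symmetry. For x > 0 one steps to i + 1, for x < 0 back to i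
- 1; if the new coordinate is nonnegative, the vector has become smaller. Otherwise the vector lies
on a segment parallel to an axis on which |f| is a concave quadratic, and both end points are on an
axis of the form at i or at a neighbouring index. -/
theorem le_abs_rootForm {a : ℤ → ℕ} (ha : ∀ i, 1 ≤ a i) {m : ℝ} (hm : ∀ i, m ≤ 1 / lam i a) :
    ∀ (n : ℕ) (i x y : ℤ), (x, y) ≠ (0, 0) → |x| + |y| ≤ n →
      m ≤ |rootForm (rightTail a i) (leftTail a i) x y| := by
  intro n
  induction n with
  | zero =>
    intro i x y hxy h
    have h1 := abs_nonneg x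
    have h2 := abs_nonneg y
    have hx : x = 0 := abs_eq_zero.1 (by omega)
    have hy : y = 0 := abs_eq_zero.1 (by omega)
    exact absurd (by rw [hx, hy]) hxy
  | succ n ih =>
    have main : ∀ i x y : ℤ, 0 < y → |x| + |y| ≤ (n + 1 : ℕ) →
        m ≤ |rootForm (rightTail a i) (leftTail a i) x y| := by
      intro i x y hy h
      have h1 := rightTail_pos ha i
      have h2 := leftTail_pos ha i
      have h3 := rightTail_pos ha (i + 1)
      have hy' : (0 : ℝ) < y := by exact_mod_cast hy
      rw [abs_of_pos hy] at h
      rcases lt_trichotomy x 0 with hx | rfl | hx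
      · rw [abs_of_neg hx] at h
        have hx' : (x : ℝ) < 0 := by exact_mod_cast hx
        have e := fun X Y => rootForm_step ha (i - 1) X Y
        rw [sub_add_cancel] at e
        have hγ := leftTail_succ ha (i - 1)
        rw [sub_add_cancel] at hγ
        have hγ0 := leftTail_pos ha (i - 1)
        have ha1 : (1 : ℤ) ≤ a (i - 1) := by exact_mod_cast ha (i - 1)
        have ha2 : (1 : ℝ) ≤ a (i - 1) := by exact_mod_cast ha (i - 1)
        rcases le_or_gt 0 (a (i - 1) * x + y) with hc | hc
        · have := ih (i - 1) (a (i - 1) * x + y) x (fun he => hx.ne (Prod.ext_iff.1 he).2) (by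
            rw [abs_of_nonneg hc, abs_of_neg hx]; push_cast at h; nlinarith)
          rw [e, abs_neg] at this
          push_cast at this
          rwa [add_sub_cancel_left] at this
        · have hc' : (a (i - 1) : ℝ) * x + y < 0 := by exact_mod_cast hc
          have b1 := le_abs_rootForm_left ha hm i hx.ne
          have b2 := le_abs_rootForm_right ha hm (i - 1) hx.ne
          rw [e, abs_neg, zero_sub] at b2
          -- This keeps the factor -x - γ t nonnegative on the whole segment, so the form has
          -- constant sign there.
          have hag : leftTail a i * a (i - 1) ≤ 1 := by
            rw [hγ, one_div_mul_eq_div, div_le_one (by positivity)]; linarith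
          set α := rightTail a i
          set γ := leftTail a i
          set A : ℝ := ((a (i - 1) : ℕ) : ℝ)
          have p1 : ∀ t : ℝ, 0 ≤ t → t ≤ -(A * x) →
              |rootForm α γ x t| = (-x + α * t) * (-x - γ * t) / (α + γ) := by
            intro t ht0 ht
            have : (0 : ℝ) ≤ -x - γ * t := by nlinarith
            have : (0 : ℝ) ≤ -x + α * t := by nlinarith [mul_nonneg h1.le ht0]
            rw [rootForm, ← abs_of_nonneg (a := (-x + α * t) * (-x - γ * t) / (α + γ))
              (by positivity)]
            congr 1; ring
          rw [p1 0 le_rfl (by nlinarith)] at b1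
          rw [p1 _ (by nlinarith) le_rfl] at b2
          rw [p1 y hy'.le (by linarith)]
          refine le_of_concave_combination hy' (by linarith : (y : ℝ) < -(A * x)) b1 b2 ?_
          have h5 : 0 ≤ α * γ * (-(A * x)) * y * (-(A * x) - y) := by
            have : 0 ≤ -(A * x) := by nlinarith
            have : 0 ≤ -(A * x) - y := by linarith
            positivity
          rw [← mul_div_assoc, ← mul_div_assoc, ← mul_div_assoc, ← add_div]
          apply div_le_div_of_nonneg_right _ (by positivity)
          linarith
      · have := le_abs_rootForm_right ha hm i hy.ne'
        simpa using this
      · rw [abs_of_pos hx] at h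
        have hx' : (0 : ℝ) < x := by exact_mod_cast hx
        have ha1 : (1 : ℤ) ≤ a i := by exact_mod_cast ha i
        have ha2 : (1 : ℝ) ≤ a i := by exact_mod_cast ha i
        rcases le_or_gt 0 (x - a i * y) with hc | hc
        · have := ih (i + 1) y (x - a i * y) (fun he => hy.ne' (Prod.ext_iff.1 he).1) (by
            rw [abs_of_nonneg hc, abs_of_pos hy]; push_cast at h; nlinarith)
          rw [rootForm_step ha, abs_neg]
          push_cast at this
          exact this
        · have hc' : (x : ℝ) - a i * y < 0 := by exact_mod_cast hc
          have b1 := le_abs_rootForm_right ha hm i hy.ne'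
          have b2 := le_abs_rootForm_left ha hm (i + 1) hy.ne'
          have e := rootForm_step ha i (a i * y) y
          rw [sub_self] at e
          rw [← abs_neg, ← e] at b2
          have hα : (a i : ℝ) ≤ rightTail a i := by
            rw [rightTail_succ ha i]
            have : 0 < 1 / rightTail a (i + 1) := by positivity
            linarith
          set α := rightTail a i
          set γ := leftTail a i
          set A : ℝ := ((a i : ℕ) : ℝ)
          have p1 : ∀ t : ℝ, 0 ≤ t → t ≤ A * y →
              |rootForm α γ t y| = (α * y - t) * (t + γ * y) / (α + γ) := by
            intro t ht0 ht
            have : (0 : ℝ) ≤ α * y - t := by nlinarith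
            have : (0 : ℝ) ≤ t + γ * y := by positivity
            rw [rootForm, ← abs_of_nonneg (a := (α * y - t) * (t + γ * y) / (α + γ))
              (by positivity), ← abs_neg]
            congr 1; ring
          rw [p1 0 le_rfl (by positivity)] at b1
          rw [p1 _ (by positivity) le_rfl] at b2
          rw [p1 x hx'.le (by linarith)]
          refine le_of_concave_combination hx' (by linarith : (x : ℝ) < A * y) b1 b2 ?_
          have h5 : 0 ≤ (A * y) * x * (A * y - x) := by
            have : 0 ≤ A * y - x := by linarith
            positivity
          rw [← mul_div_assoc, ← mul_div_assoc, ← mul_div_assoc, ← add_div]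
          apply div_le_div_of_nonneg_right _ (by positivity)
          linarith
    intro i x y hxy h
    rcases lt_trichotomy y 0 with hy | rfl | hy
    · have := main i (-x) (-y) (by omega) (by rwa [abs_neg, abs_neg])
      push_cast at this
      rwa [rootForm_neg] at this
    · have hx : x ≠ 0 := fun hx => hxy (by rw [hx])
      have := le_abs_rootForm_left ha hm i hx
      simpa using this
    · exact main i x y hy h

/-- The witness is `rootForm` at index 0. Its value at (1, 0) is 1 / λ_0, and the descent shows that
no nonzero integer vector gives less in absolute value. -/
theorem lam_mem_markovSpectrum {a : ℤ → ℕ} (ha : ∀ i, 1 ≤ a i) (h : ∀ i, lam i a ≤ lam 0 a) :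
    lam 0 a ∈ markovSpectrum := by
  have h1 := rightTail_pos ha 0
  have h2 := leftTail_pos ha 0
  have hpos : ∀ i, 0 < lam i a := fun i => by
    rw [lam_eq_tails ha]; exact add_pos (rightTail_pos ha i) (leftTail_pos ha i)
  have hne : rightTail a 0 + leftTail a 0 ≠ 0 := by positivity
  have hinf : formInf (1 / (rightTail a 0 + leftTail a 0))
      ((leftTail a 0 - rightTail a 0) / (rightTail a 0 + leftTail a 0))
      (-(rightTail a 0 * leftTail a 0) / (rightTail a 0 + leftTail a 0)) = 1 / lam 0 a := by
    have e : ∀ x y : ℝ, 1 / (rightTail a 0 + leftTail a 0) * x ^ 2 +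
        (leftTail a 0 - rightTail a 0) / (rightTail a 0 + leftTail a 0) * x * y +
        -(rightTail a 0 * leftTail a 0) / (rightTail a 0 + leftTail a 0) * y ^ 2 =
        rootForm (rightTail a 0) (leftTail a 0) x y := by
      intro x y; rw [rootForm]; field_simp; ring
    rw [formInf]
    simp only [e]
    apply le_antisymm
    · have := ciInf_le (f := fun v : {v : ℤ × ℤ // v ≠ (0, 0)} =>
        |rootForm (rightTail a 0) (leftTail a 0) v.1.1 v.1.2|)
        ⟨0, by rintro _ ⟨v, rfl⟩; exact abs_nonneg _⟩ ⟨(1, 0), by simp⟩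
      refine this.trans (le_of_eq ?_)
      rw [lam_eq_tails ha, rootForm]
      simp only [Int.cast_one, Int.cast_zero, mul_zero, sub_zero, add_zero, mul_one]
      exact abs_of_pos (by positivity)
    · have : Nonempty {v : ℤ × ℤ // v ≠ (0, 0)} := ⟨⟨(1, 0), by simp⟩⟩
      refine le_ciInf fun v => le_abs_rootForm ha
        (fun i => one_div_le_one_div_of_le (hpos i) (h i)) (|v.1.1| + |v.1.2|).toNat 0 _ _ v.2 ?_
      rw [Int.toNat_of_nonneg (by positivity)]
  refine ⟨1 / (rightTail a 0 + leftTail a 0),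
    (leftTail a 0 - rightTail a 0) / (rightTail a 0 + leftTail a 0),
    -(rightTail a 0 * leftTail a 0) / (rightTail a 0 + leftTail a 0), ?_, ?_, ?_⟩
  · field_simp; ring
  · rw [hinf]; exact one_div_pos.2 (hpos 0)
  · rw [hinf, one_div_one_div]

/-! ### Approximation of irrational numbers -/

/-- The complete quotients of the continued fraction of `ξ`. -/
noncomputable def completeQuotient (ξ : ℝ) : ℕ → ℝ
  | 0 => ξ
  | n + 1 => (Int.fract (completeQuotient ξ n))⁻¹

/-- Numerators of the convergents of `ξ`, starting with the index `-1`. -/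
noncomputable def cfNum (ξ : ℝ) : ℕ → ℤ
  | 0 => 1
  | 1 => ⌊ξ⌋
  | n + 2 => ⌊completeQuotient ξ (n + 1)⌋ * cfNum ξ (n + 1) + cfNum ξ n

/-- Denominators of the convergents of `ξ`, starting with the index `-1`. -/
noncomputable def cfDen (ξ : ℝ) : ℕ → ℤ
  | 0 => 0
  | 1 => 1
  | n + 2 => ⌊completeQuotient ξ (n + 1)⌋ * cfDen ξ (n + 1) + cfDen ξ n

theorem completeQuotient_shift (ξ : ℝ) (n : ℕ) :
    completeQuotient ξ (n + 1) = completeQuotient (Int.fract ξ)⁻¹ n := by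
  induction n with
  | zero => rfl
  | succ n ih => rw [completeQuotient, ih, completeQuotient]

/-- The defining recursion appends the last quotient, while `Real.convergent` peels off the first;
this and `cfDen_succ` connect the two. -/
theorem cfNum_succ (ξ : ℝ) (n : ℕ) :
    cfNum ξ (n + 1) = ⌊ξ⌋ * cfNum (Int.fract ξ)⁻¹ n + cfDen (Int.fract ξ)⁻¹ n := by
  induction n using Nat.twoStepInduction with
  | zero => simp [cfNum, cfDen]
  | one => simp [cfNum, cfDen, completeQuotient, mul_comm]
  | more n ih1 ih2 =>
    rw [cfNum, ih1, ih2, cfNum, cfDen, completeQuotient_shift]; ring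

theorem cfDen_succ (ξ : ℝ) (n : ℕ) : cfDen ξ (n + 1) = cfNum (Int.fract ξ)⁻¹ n := by
  induction n using Nat.twoStepInduction with
  | zero => simp [cfNum, cfDen]
  | one => simp [cfNum, cfDen, completeQuotient]
  | more n ih1 ih2 => rw [cfDen, ih1, ih2, cfNum, completeQuotient_shift]

theorem irrational_inv_fract {ξ : ℝ} (h : Irrational ξ) : Irrational (Int.fract ξ)⁻¹ :=
  irrational_inv_iff.2 (h.sub_intCast ⌊ξ⌋)

theorem irrational_completeQuotient {ξ : ℝ} (h : Irrational ξ) (n : ℕ) :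
    Irrational (completeQuotient ξ n) := by
  induction n with
  | zero => exact h
  | succ n ih => exact irrational_inv_fract ih

theorem one_lt_completeQuotient {ξ : ℝ} (h : Irrational ξ) (n : ℕ) :
    1 < completeQuotient ξ (n + 1) :=
  (one_lt_inv₀ (Int.fract_pos.2 ((irrational_completeQuotient h n).ne_int _))).2
    (Int.fract_lt_one _)

theorem completeQuotient_eq (ξ : ℝ) (n : ℕ) :
    completeQuotient ξ n = ⌊completeQuotient ξ n⌋ + 1 / completeQuotient ξ (n + 1) := by
  rw [completeQuotient, one_div, inv_inv, Int.floor_add_fract]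

theorem one_le_floor_completeQuotient {ξ : ℝ} (h : Irrational ξ) (n : ℕ) :
    1 ≤ ⌊completeQuotient ξ (n + 1)⌋ :=
  Int.le_floor.2 (by exact_mod_cast (one_lt_completeQuotient h n).le)

theorem cfDen_bounds {ξ : ℝ} (h : Irrational ξ) (n : ℕ) :
    0 ≤ cfDen ξ n ∧ 1 ≤ cfDen ξ (n + 1) ∧ n ≤ cfDen ξ (n + 1) := by
  have key : ∀ n : ℕ, 0 ≤ cfDen ξ n ∧ 1 ≤ cfDen ξ (n + 1) ∧ n ≤ cfDen ξ (n + 1) ∧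
      (n = 0 ∨ 1 ≤ cfDen ξ n) := by
    intro n
    induction n with
    | zero => simp [cfDen]
    | succ n ih =>
      have h1 := one_le_floor_completeQuotient h n
      obtain ⟨h2, h3, h4, h5⟩ := ih
      have h6 : cfDen ξ (n + 1) ≤ ⌊completeQuotient ξ (n + 1)⌋ * cfDen ξ (n + 1) :=
        le_mul_of_one_le_left (by omega) h1
      have h7 : cfDen ξ (n + 1 + 1) = ⌊completeQuotient ξ (n + 1)⌋ * cfDen ξ (n + 1) + cfDen ξ n :=
        rfl
      refine ⟨by omega, by omega, ?_, Or.inr h3⟩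
      rcases h5 with h5 | h5 <;> push_cast <;> omega
  exact ⟨(key n).1, (key n).2.1, (key n).2.2.1⟩

theorem convergent_eq (n : ℕ) : ∀ {ξ : ℝ}, Irrational ξ →
    ξ.convergent n = (cfNum ξ (n + 1) : ℚ) / cfDen ξ (n + 1) := by
  induction n with
  | zero => intro ξ _; simp [cfNum, cfDen]
  | succ n ih =>
    intro ξ h
    have h2 := (cfDen_bounds h (n + 1)).2.1
    rw [cfDen_succ] at h2
    have h2' : (cfNum (Int.fract ξ)⁻¹ (n + 1) : ℚ) ≠ 0 := by exact_mod_cast (by omega)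
    rw [Real.convergent_succ, ih (irrational_inv_fract h), cfNum_succ ξ (n + 1),
      cfDen_succ ξ (n + 1)]
    push_cast
    rw [inv_div, add_div, mul_div_cancel_right₀ _ h2']

theorem mul_cfDen_eq {ξ : ℝ} (h : Irrational ξ) (n : ℕ) :
    ξ * (cfDen ξ (n + 1) * completeQuotient ξ (n + 1) + cfDen ξ n) =
      cfNum ξ (n + 1) * completeQuotient ξ (n + 1) + cfNum ξ n := by
  induction n with
  | zero =>
    have h1 := one_lt_completeQuotient h 0
    have h2 := completeQuotient_eq ξ 0
    simp only [completeQuotient, cfNum, cfDen, Int.cast_one, Int.cast_zero, add_zero,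
      one_mul] at h1 h2 ⊢
    generalize (Int.fract ξ)⁻¹ = x at h1 h2 ⊢
    have hx : x ≠ 0 := by positivity
    field_simp at h2
    exact h2
  | succ n ih =>
    have h1 := one_lt_completeQuotient h (n + 1)
    rw [completeQuotient_eq ξ (n + 1)] at ih
    rw [cfDen, cfNum]
    push_cast
    have h2 : completeQuotient ξ (n + 1 + 1) ≠ 0 := by positivity
    field_simp at ih
    linear_combination ih

theorem cfNum_mul_cfDen_sub (ξ : ℝ) (n : ℕ) :
    cfNum ξ (n + 1) * cfDen ξ n - cfNum ξ n * cfDen ξ (n + 1) = (-1) ^ (n + 1) := by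
  induction n with
  | zero => simp [cfNum, cfDen]
  | succ n ih =>
    rw [cfNum, cfDen, pow_succ]
    linear_combination -ih

theorem isCoprime_cfNum_cfDen (ξ : ℝ) (n : ℕ) : IsCoprime (cfNum ξ (n + 1)) (cfDen ξ (n + 1)) := by
  have h := cfNum_mul_cfDen_sub ξ n
  have h2 : ((-1 : ℤ) ^ (n + 1)) * (-1) ^ (n + 1) = 1 := by rw [← mul_pow]; simp
  exact ⟨(-1) ^ (n + 1) * cfDen ξ n, -(-1) ^ (n + 1) * cfNum ξ n, by
    linear_combination (-1) ^ (n + 1) * h + h2⟩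

theorem abs_cfDen_mul_sub {ξ : ℝ} (h : Irrational ξ) (n : ℕ) :
    |cfDen ξ (n + 1) * ξ - cfNum ξ (n + 1)| =
      1 / (cfDen ξ (n + 1) * completeQuotient ξ (n + 1) + cfDen ξ n) := by
  have h1 := one_lt_completeQuotient h n
  have h2 := cfDen_bounds h n
  have h3 : (1 : ℝ) ≤ cfDen ξ (n + 1) := by exact_mod_cast h2.2.1
  have h4 : (0 : ℝ) ≤ cfDen ξ n := by exact_mod_cast h2.1
  have h5 : 0 < cfDen ξ (n + 1) * completeQuotient ξ (n + 1) + cfDen ξ n := by positivity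
  have h6 : (cfNum ξ (n + 1) : ℝ) * cfDen ξ n - cfNum ξ n * cfDen ξ (n + 1) = (-1) ^ (n + 1) := by
    exact_mod_cast cfNum_mul_cfDen_sub ξ n
  rw [eq_div_iff h5.ne', ← abs_of_pos h5, ← abs_mul]
  have : (cfDen ξ (n + 1) * ξ - cfNum ξ (n + 1)) *
      (cfDen ξ (n + 1) * completeQuotient ξ (n + 1) + cfDen ξ n) = -(-1) ^ (n + 1) := by
    linear_combination cfDen ξ (n + 1) * mul_cfDen_eq h n - h6
  rw [this, abs_neg, abs_pow]; simp

/-- The quality of the approximation of `ξ` by `p / q`. -/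
noncomputable def approxQuality (ξ : ℝ) (z : ℤ × ℤ) : ℝ :=
  1 / |(z.2 : ℝ) * ((z.2 : ℝ) * ξ - (z.1 : ℝ))|

theorem approxQuality_convergent {ξ : ℝ} (h : Irrational ξ) (n : ℕ) :
    approxQuality ξ (cfNum ξ (n + 1), cfDen ξ (n + 1)) =
      completeQuotient ξ (n + 1) + cfDen ξ n / cfDen ξ (n + 1) := by
  have h1 := one_lt_completeQuotient h n
  have h2 := cfDen_bounds h n
  have h3 : (1 : ℝ) ≤ cfDen ξ (n + 1) := by exact_mod_cast h2.2.1
  have h4 : (0 : ℝ) ≤ cfDen ξ n := by exact_mod_cast h2.1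
  have h5 : 0 < cfDen ξ (n + 1) * completeQuotient ξ (n + 1) + cfDen ξ n := by positivity
  rw [approxQuality, abs_mul, abs_cfDen_mul_sub h, abs_of_pos (by linarith)]
  field_simp

/-- The partial quotients of `ξ` with positive index, preceded by letters `1`. -/
noncomputable def quotientSeq (ξ : ℝ) (i : ℤ) : ℕ :=
  if 1 ≤ i then ⌊completeQuotient ξ i.toNat⌋.toNat else 1

theorem quotientSeq_natCast {ξ : ℝ} (h : Irrational ξ) (n : ℕ) :
    (quotientSeq ξ (n + 1 : ℕ) : ℝ) = ⌊completeQuotient ξ (n + 1)⌋ := by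
  have h1 := one_le_floor_completeQuotient h n
  have h2 : ((⌊completeQuotient ξ (n + 1)⌋.toNat : ℕ) : ℤ) = ⌊completeQuotient ξ (n + 1)⌋ :=
    Int.toNat_of_nonneg (by omega)
  rw [quotientSeq, if_pos (by push_cast; omega), Int.toNat_natCast]
  exact_mod_cast h2

theorem one_le_quotientSeq {ξ : ℝ} (h : Irrational ξ) (i : ℤ) : 1 ≤ quotientSeq ξ i := by
  rw [quotientSeq]
  split_ifs with hi
  · obtain ⟨n, hn⟩ : ∃ n, i.toNat = n + 1 := ⟨i.toNat - 1, by omega⟩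
    have := one_le_floor_completeQuotient h n
    rw [hn]; omega
  · rfl

theorem rightTail_quotientSeq {ξ : ℝ} (h : Irrational ξ) (n : ℕ) :
    rightTail (quotientSeq ξ) (n + 1 : ℕ) = completeQuotient ξ (n + 1) := by
  have := cfValue_eq_of_recurrence (fun k => quotientSeq ξ ((n + 1 : ℕ) + k))
    (fun k => one_le_quotientSeq h _) (fun k => completeQuotient ξ (n + k + 1)) (fun k => by
      have e : ((n + 1 : ℕ) + k : ℤ) = ((n + k + 1 : ℕ) : ℤ) := by push_cast; ring
      rw [e, quotientSeq_natCast h]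
      exact completeQuotient_eq _ _) fun k => (one_lt_completeQuotient h _).le
  simpa [rightTail] using this

/-- Both quantities obey t ↦ 1/(a + t) with the same letters and differ only in their initial value,
which two-step contraction forgets. So the artificial letters 1 at indices i ≤ 0 do not affect the
limit. -/
theorem abs_leftTail_sub_le {ξ : ℝ} (h : Irrational ξ) (n : ℕ) :
    |leftTail (quotientSeq ξ) (n + 1 : ℕ) - cfDen ξ n / cfDen ξ (n + 1)| ≤ (1 / 4) ^ (n / 2) := by
  have hb := one_le_quotientSeq h
  have hL : ∀ n : ℕ, 0 ≤ leftTail (quotientSeq ξ) (n + 1 : ℕ) ∧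
      leftTail (quotientSeq ξ) (n + 1 : ℕ) ≤ 1 := fun n =>
    ⟨(leftTail_pos hb _).le, by
      have := one_le_cfValue (fun k => quotientSeq ξ ((n + 1 : ℕ) - 1 - k)) fun _ => hb _
      rw [leftTail, div_le_one (by linarith)]; exact this⟩
  have hR : ∀ n : ℕ, 0 ≤ (cfDen ξ n / cfDen ξ (n + 1) : ℝ) := fun n => by
    have h2 := cfDen_bounds h n
    have h3 : (1 : ℝ) ≤ cfDen ξ (n + 1) := by exact_mod_cast h2.2.1
    have h4 : (0 : ℝ) ≤ cfDen ξ n := by exact_mod_cast h2.1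
    positivity
  have sL : ∀ n : ℕ, leftTail (quotientSeq ξ) (n + 1 + 1 : ℕ) =
      1 / (⌊completeQuotient ξ (n + 1)⌋ + leftTail (quotientSeq ξ) (n + 1 : ℕ)) := fun n => by
    rw [← quotientSeq_natCast h, ← leftTail_succ hb]; norm_cast
  have sR : ∀ n : ℕ, (cfDen ξ (n + 1) / cfDen ξ (n + 1 + 1) : ℝ) =
      1 / (⌊completeQuotient ξ (n + 1)⌋ + cfDen ξ n / cfDen ξ (n + 1)) := fun n => by
    have h2 := cfDen_bounds h n
    have h3 : (1 : ℝ) ≤ cfDen ξ (n + 1) := by exact_mod_cast h2.2.1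
    have h4 : (0 : ℝ) ≤ cfDen ξ n := by exact_mod_cast h2.1
    have h5 : (1 : ℝ) ≤ ⌊completeQuotient ξ (n + 1)⌋ := by
      exact_mod_cast one_le_floor_completeQuotient h n
    rw [cfDen]; push_cast; field_simp
  have hfl : ∀ n, (1 : ℝ) ≤ ⌊completeQuotient ξ (n + 1)⌋ := fun n => by
    exact_mod_cast one_le_floor_completeQuotient h n
  induction n using Nat.twoStepInduction with
  | zero =>
    have := hL 0
    simp only [cfDen, Int.cast_zero, zero_div, sub_zero, Nat.zero_div, pow_zero]
    rw [abs_of_nonneg this.1]; exact this.2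
  | one =>
    have h1 := hL 1
    have h2 := hR 1
    have h3 : (cfDen ξ 1 / cfDen ξ (1 + 1) : ℝ) ≤ 1 := by
      have h5 := hfl 0
      rw [sR 0, div_le_one (by linarith [hR 0])]
      linarith [hR 0]
    rw [abs_le]; norm_num at h1 h2 h3 ⊢; constructor <;> linarith
  | more n ih _ =>
    have := abs_sub_le_of_two_steps (a := 0) (hfl (n + 1))
      (x := ⌊completeQuotient ξ (n + 1)⌋ + leftTail (quotientSeq ξ) (n + 1 : ℕ))
      (y := ⌊completeQuotient ξ (n + 1)⌋ + cfDen ξ n / cfDen ξ (n + 1))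
      (by linarith [hfl n, hL n]) (by linarith [hfl n, hR n])
    rw [← sL, ← sR, zero_add, zero_add, ← sL (n + 1), ← sR (n + 1), add_sub_add_left_eq_sub] at this
    rw [show (n + 2) / 2 = n / 2 + 1 by omega, pow_succ]
    exact this.trans (by linarith)

/-- The values of `λ` are asymptotic to the approximation qualities of the convergents. -/
theorem abs_lam_sub_le {ξ : ℝ} (h : Irrational ξ) (n : ℕ) :
    |lam (n + 1 : ℕ) (quotientSeq ξ) - approxQuality ξ (cfNum ξ (n + 1), cfDen ξ (n + 1))| ≤
      (1 / 4) ^ (n / 2) := by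
  rw [lam_eq_tails (one_le_quotientSeq h), approxQuality_convergent h, rightTail_quotientSeq h,
    add_sub_add_left_eq_sub]
  exact abs_leftTail_sub_le h n

theorem tendsto_cofinite_of_linear_growth {f : ℕ → ℤ} {c d : ℝ} (hc : 0 < c)
    (hf : ∀ n : ℕ, c * n - d ≤ |(f n : ℝ)|) : Tendsto f atTop cofinite := by
  refine le_cofinite_iff_eventually_ne.2 fun x => ?_
  have h1 : Tendsto (fun n : ℕ => c * n - d) atTop atTop :=
    tendsto_atTop_add_const_right _ _ (tendsto_natCast_atTop_atTop.const_mul_atTop hc)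
  refine eventually_map.2 ((h1.eventually_gt_atTop |(x : ℝ)|).mono fun n hn he => ?_)
  have := hf n
  rw [he] at this
  linarith

theorem tendsto_convergents {ξ : ℝ} (h : Irrational ξ) :
    Tendsto (fun n => (cfNum ξ (n + 1), cfDen ξ (n + 1))) atTop (cofinite ×ˢ cofinite) := by
  have hn : ∀ n : ℕ, (n : ℝ) ≤ cfDen ξ (n + 1) := fun n => by exact_mod_cast (cfDen_bounds h n).2.2
  refine Tendsto.prodMk (tendsto_cofinite_of_linear_growth (c := |ξ|) (d := 1)
    (abs_pos.2 h.ne_zero) fun n => ?_)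
    (tendsto_cofinite_of_linear_growth (c := 1) (d := 0) one_pos fun n => ?_)
  · have h1 := one_lt_completeQuotient h n
    have h2 := cfDen_bounds h n
    have h3 : (1 : ℝ) ≤ cfDen ξ (n + 1) := by exact_mod_cast h2.2.1
    have h4 : (0 : ℝ) ≤ cfDen ξ n := by exact_mod_cast h2.1
    have h5 : |cfDen ξ (n + 1) * ξ - cfNum ξ (n + 1)| ≤ 1 := by
      rw [abs_cfDen_mul_sub h, div_le_one (by positivity)]; nlinarith
    have h6 := abs_sub_abs_le_abs_sub (cfDen ξ (n + 1) * ξ) (cfNum ξ (n + 1))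
    rw [abs_mul, abs_of_pos (by linarith : (0 : ℝ) < cfDen ξ (n + 1))] at h6
    have h7 := mul_le_mul_of_nonneg_right (hn n) (abs_nonneg ξ)
    linarith
  · rw [one_mul, sub_zero]; exact (hn n).trans (le_abs_self _)

/-- A good approximation is, up to a common factor, a convergent. -/
theorem exists_convergent_of_two_lt {ξ : ℝ} (h : Irrational ξ) {z : ℤ × ℤ}
    (hz : 2 < approxQuality ξ z) : ∃ n : ℕ,
      (z.1 : ℝ) / z.2 = (cfNum ξ (n + 1) : ℝ) / cfDen ξ (n + 1) ∧
      approxQuality ξ z ≤ approxQuality ξ (cfNum ξ (n + 1), cfDen ξ (n + 1)) ∧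
      |ξ - (z.1 : ℝ) / z.2| < 1 / (2 * (z.2 : ℝ) ^ 2) := by
  obtain ⟨p, q⟩ := z
  have hq : q ≠ 0 := by
    rintro rfl
    norm_num [approxQuality] at hz
  have hq' : (q : ℝ) ≠ 0 := by exact_mod_cast hq
  have val : ∀ p q : ℤ, q ≠ 0 → |(q : ℝ) * (q * ξ - p)| = (q : ℝ) ^ 2 * |ξ - p / q| := by
    intro p q hq
    have hq' : (q : ℝ) ≠ 0 := by exact_mod_cast hq
    rw [← abs_of_nonneg (sq_nonneg (q : ℝ)), ← abs_mul]
    congr 1; field_simp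
  have hpos : ∀ p q : ℤ, 0 < |ξ - (p : ℝ) / q| := fun p q => by
    rw [abs_pos, sub_ne_zero]
    exact_mod_cast h.ne_rat ((p : ℚ) / q)
  have hq2 : (0 : ℝ) < (q : ℝ) ^ 2 := by positivity
  have hclose : |ξ - (p : ℝ) / q| < 1 / (2 * (q : ℝ) ^ 2) := by
    simp only [approxQuality] at hz
    have := hpos p q
    rw [val p q hq, lt_div_iff₀ (by positivity)] at hz
    rw [lt_div_iff₀ (by positivity)]; linarith
  have hden : ((((p : ℚ) / q).den : ℤ) : ℝ) ^ 2 ≤ (q : ℝ) ^ 2 := by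
    have h1 : (((p : ℚ) / q).den : ℤ) ∣ q := by
      rw [← Rat.divInt_eq_div]; exact Rat.den_dvd p q
    have h2 := Nat.le_of_dvd (Int.natAbs_pos.2 hq) (Int.natAbs_dvd_natAbs.2 h1)
    have h3 := Int.natAbs_le_iff_sq_le.1 h2
    exact_mod_cast h3
  -- Legendre's theorem needs the reduced denominator, which is at most |q|.
  obtain ⟨n, hn⟩ := Real.exists_rat_eq_convergent (ξ := ξ) (q := (p : ℚ) / q) (by
    push_cast
    refine hclose.trans_le (one_div_le_one_div_of_le ?_ ?_)
    · have := ((p : ℚ) / q).den_pos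
      positivity
    · push_cast at hden; linarith)
  rw [convergent_eq n h] at hn
  have hn' : (p : ℝ) / q = (cfNum ξ (n + 1) : ℝ) / cfDen ξ (n + 1) := by exact_mod_cast hn
  have hQ := (cfDen_bounds h n).2.1
  refine ⟨n, hn', ?_, hclose⟩
  -- The convergent is in lowest terms, so it is the same fraction with a denominator no larger in
  -- size, hence of no smaller quality.
  have hdvd : cfDen ξ (n + 1) ∣ q := by
    have e : p * cfDen ξ (n + 1) = cfNum ξ (n + 1) * q := by
      rw [div_eq_div_iff hq' (by exact_mod_cast (by omega : cfDen ξ (n + 1) ≠ 0))] at hn'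
      exact_mod_cast hn'
    exact (isCoprime_cfNum_cfDen ξ n).symm.dvd_of_dvd_mul_left ⟨p, by rw [← e, mul_comm]⟩
  have hle : (cfDen ξ (n + 1) : ℝ) ^ 2 ≤ (q : ℝ) ^ 2 := by
    have h3 := Int.natAbs_le_iff_sq_le.1 (Nat.le_of_dvd (Int.natAbs_pos.2 hq)
      (Int.natAbs_dvd_natAbs.2 hdvd))
    exact_mod_cast h3
  simp only [approxQuality]
  rw [val p q hq, val _ _ (by omega : cfDen ξ (n + 1) ≠ 0), hn']
  have h1 := hpos (cfNum ξ (n + 1)) (cfDen ξ (n + 1))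
  have h2 : (0 : ℝ) < cfDen ξ (n + 1) := by exact_mod_cast (by omega : 0 < cfDen ξ (n + 1))
  exact one_div_le_one_div_of_le (by positivity) (by gcongr)

/-- Every element of the Lagrange spectrum above `2` is the upper limit of `λ` along a sequence. -/
theorem exists_seq_of_mem_lagrangeSpectrum {ℓ : ℝ} (hℓ : ℓ ∈ lagrangeSpectrum) :
    ∃ b : ℤ → ℕ, (∀ i, 1 ≤ b i) ∧ (∀ u, ℓ < u → ∃ N : ℤ, ∀ i, N ≤ i → lam i b < u) ∧
      ∀ u, 2 ≤ u → u < ℓ → ∀ M : ℤ, ∃ i, M ≤ i ∧ u < lam i b := by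
  obtain ⟨ξ, h, hlim⟩ := hℓ
  change limsup (fun z => (approxQuality ξ z : EReal)) _ = _ at hlim
  refine ⟨quotientSeq ξ, one_le_quotientSeq h, fun u hu => ?_, fun u hu2 hu M => ?_⟩
  · obtain ⟨v, hv1, hv2⟩ := exists_between hu
    have h1 : ∀ᶠ z in cofinite ×ˢ cofinite, (approxQuality ξ z : EReal) < v :=
      eventually_lt_of_limsup_lt (by rw [hlim]; exact_mod_cast hv1)
    have h2 := (tendsto_convergents h).eventually h1
    have h3 := tendsto_quarter_pow.eventually_lt_const (sub_pos.2 hv2)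
    obtain ⟨N, hN⟩ := eventually_atTop.1 (h2.and h3)
    refine ⟨N + 1, fun i hi => ?_⟩
    obtain ⟨n, rfl⟩ : ∃ n : ℕ, i = (n + 1 : ℕ) := ⟨(i - 1).toNat, by omega⟩
    obtain ⟨h4, h5⟩ := hN n (by omega)
    have h6 : approxQuality ξ (cfNum ξ (n + 1), cfDen ξ (n + 1)) < v := by exact_mod_cast h4
    have h7 := abs_le.1 (abs_lam_sub_le h n)
    linarith
  · obtain ⟨v, hv1, hv2⟩ := exists_between hu
    have h1 : ∃ᶠ z in cofinite ×ˢ cofinite, (v : EReal) < approxQuality ξ z :=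
      frequently_lt_of_lt_limsup (h := by rw [hlim]; exact_mod_cast hv2)
    have h3 := tendsto_quarter_pow.eventually_lt_const (sub_pos.2 hv1)
    obtain ⟨N, hN⟩ := eventually_atTop.1 h3
    set K := max N M.toNat
    -- The finitely many convergents of index below K stay at positive distance from ξ, so a good
    -- fraction with large denominator must be a later one.
    have h4 : ∀ᶠ z : ℤ × ℤ in cofinite ×ˢ cofinite, ∀ n ∈ Finset.range K,
        1 / (2 * (z.2 : ℝ) ^ 2) ≤ |ξ - (cfNum ξ (n + 1) : ℝ) / cfDen ξ (n + 1)| := by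
      rw [eventually_all_finset]
      intro n _
      have hpos : 0 < |ξ - (cfNum ξ (n + 1) : ℝ) / cfDen ξ (n + 1)| := by
        rw [abs_pos, sub_ne_zero]
        exact_mod_cast h.ne_rat ((cfNum ξ (n + 1) : ℚ) / cfDen ξ (n + 1))
      have hfin : ∀ᶠ q : ℤ in cofinite, 1 / (2 * (q : ℝ) ^ 2) ≤
          |ξ - (cfNum ξ (n + 1) : ℝ) / cfDen ξ (n + 1)| := by
        generalize |ξ - (cfNum ξ (n + 1) : ℝ) / cfDen ξ (n + 1)| = δ at hpos
        refine (Set.finite_Icc (-⌈1 / δ⌉) ⌈1 / δ⌉).subset fun q hq => ?_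
        rw [Set.mem_compl_iff, Set.mem_ofPred_eq, not_le] at hq
        rw [Set.mem_Icc, ← abs_le]
        by_contra! hlt
        have h5 : 1 / δ ≤ |(q : ℝ)| := (Int.le_ceil _).trans (by exact_mod_cast hlt.le)
        have h6 : (1 : ℝ) ≤ |(q : ℝ)| := by
          have : 0 < ⌈1 / δ⌉ := Int.ceil_pos.2 (by positivity)
          exact_mod_cast (by omega : (1 : ℤ) ≤ |q|)
        rw [lt_div_iff₀ (by rw [← sq_abs]; positivity), ← sq_abs] at hq
        rw [div_le_iff₀ hpos] at h5
        nlinarith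
      exact tendsto_snd.eventually hfin
    obtain ⟨z, hz1, hz2⟩ := (h1.and_eventually h4).exists
    have hz1 : v < approxQuality ξ z := by exact_mod_cast hz1
    obtain ⟨n, e1, e2, e3⟩ := exists_convergent_of_two_lt h (by linarith : 2 < approxQuality ξ z)
    have hnK : K ≤ n := by
      by_contra hlt
      have := hz2 n (Finset.mem_range.2 (by omega))
      rw [← e1] at this
      linarith
    refine ⟨(n + 1 : ℕ), by omega, ?_⟩
    have h5 := hN n (by omega)
    have h6 := abs_le.1 (abs_lam_sub_le h n)
    linarith

/-! ### The sequences `seqC θ` -/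

/-- The letters of `seqC θ` at the positions below `20`, which do not depend on `θ`. -/
def coreLetter (i : ℤ) : ℕ :=
  if i < 0 then periodicWord i
  else [3, 2, 2, 2, 1, 2, 3, 3, 2, 2, 2, 1, 2, 2, 1, 2, 1, 2, 1, 2].getD i.toNat 0

theorem seqC_of_ge (θ : ℕ → ℕ) {i : ℤ} (hi : 20 ≤ i) : seqC θ i = θ (i - 20).toNat := by
  obtain ⟨n, rfl⟩ : ∃ n : ℕ, i = ((n + 20 : ℕ) : ℤ) := ⟨(i - 20).toNat, by omega⟩
  rw [show (((n + 20 : ℕ) : ℤ) - 20).toNat = n by omega]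
  change (if n + 20 < 20 then
    [3, 2, 2, 2, 1, 2, 3, 3, 2, 2, 2, 1, 2, 2, 1, 2, 1, 2, 1, 2].getD (n + 20) 0
    else θ (n + 20 - 20)) = θ n
  rw [if_neg (by omega), Nat.add_sub_cancel]

theorem seqC_of_lt (θ : ℕ → ℕ) {i : ℤ} (hi : i < 20) : seqC θ i = coreLetter i := by
  rcases lt_or_ge i 0 with h | h
  · obtain ⟨n, rfl⟩ : ∃ n : ℕ, i = Int.negSucc n := ⟨(-1 - i).toNat, by omega⟩
    rw [coreLetter, if_pos h, periodicWord]
    change (if n < 1 then [3].getD n 0 else [2, 1, 2, 2, 2, 3, 3].getD ((n - 1) % 7) 0) = _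
    rw [show (Int.negSucc n % 7).toNat = 6 - n % 7 by omega]
    split_ifs with h1
    · obtain rfl : n = 0 := by omega
      rfl
    -- The extra letter 3 between the repeated word and the origin shifts the phase by one.
    · rw [show (n - 1) % 7 = (n % 7 + 6) % 7 by omega]
      have key : ∀ m < 7, [2, 1, 2, 2, 2, 3, 3].getD ((m + 6) % 7) 0 =
          [3, 2, 2, 2, 1, 2, 3].getD (6 - m) 0 := by decide
      exact key _ (Nat.mod_lt _ (by norm_num))
  · obtain ⟨n, rfl⟩ : ∃ n : ℕ, i = (n : ℤ) := ⟨i.toNat, by omega⟩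
    rw [coreLetter, if_neg (by omega)]
    change (if n < 20 then _ else _) = _
    rw [if_pos (by omega), Int.toNat_natCast]

theorem coreLetter_bounds {i : ℤ} (hi : i < 20) : 1 ≤ coreLetter i ∧ coreLetter i ≤ 3 := by
  rw [coreLetter]
  split_ifs with h
  · exact periodicWord_pos i
  · have key : ∀ n < 20,
        1 ≤ [3, 2, 2, 2, 1, 2, 3, 3, 2, 2, 2, 1, 2, 2, 1, 2, 1, 2, 1, 2].getD n 0 ∧
        [3, 2, 2, 2, 1, 2, 3, 3, 2, 2, 2, 1, 2, 2, 1, 2, 1, 2, 1, 2].getD n 0 ≤ 3 := by decide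
    exact key _ (by omega)

theorem coreLetter_eq_periodicWord {i : ℤ} (hi : i ≤ 12) : coreLetter i = periodicWord i := by
  rw [coreLetter]
  split_ifs with h
  · rfl
  · have key : ∀ n < 13,
        [3, 2, 2, 2, 1, 2, 3, 3, 2, 2, 2, 1, 2, 2, 1, 2, 1, 2, 1, 2].getD n 0 =
        periodicWord n := by decide
    rw [key _ (by omega), Int.toNat_of_nonneg (by omega)]

theorem seqC_le_two {θ : ℕ → ℕ} (hθ : ∀ n, θ n = 1 ∨ θ n = 2) {i : ℤ} (hi : 20 ≤ i) :
    seqC θ i ≤ 2 := by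
  rw [seqC_of_ge θ hi]
  rcases hθ (i - 20).toNat with h | h <;> omega

theorem seqC_bounds {θ : ℕ → ℕ} (hθ : ∀ n, θ n = 1 ∨ θ n = 2) (i : ℤ) :
    1 ≤ seqC θ i ∧ seqC θ i ≤ 3 := by
  rcases lt_or_ge i 20 with h | h
  · rw [seqC_of_lt θ h]; exact coreLetter_bounds h
  · rw [seqC_of_ge θ h]
    rcases hθ (i - 20).toNat with h | h <;> omega

/-- The values of `λ` at the positions `s, ..., s + m - 1` are at most `n / d` if the letters below
the position `20` imply it. -/
theorem lam_seqC_le {θ : ℕ → ℕ} (hθ : ∀ n, θ n = 1 ∨ θ n = 2) {n d : ℕ} (hd : 0 < d) (s : ℤ)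
    (k l m : ℕ) (hs : s + l ≤ 20)
    (h : allLe n d m (leftWord (fun i => coreLetter (s + i)) k)
      (rightWord (fun i => coreLetter (s + i)) l) = true) :
    ∀ i, s ≤ i → i < s + m → lam i (seqC θ) ≤ (n : ℝ) / d := by
  intro i h1 h2
  have := allLe_sound hd m _ _ (fun i => seqC θ (s + i)) (fun i => (seqC_bounds hθ _).1)
    (fits_leftWord (fun i => (seqC_bounds hθ _).1) (fun i _ _ => seqC_of_lt θ (by omega))
      fun i _ _ => (seqC_bounds hθ _).2)
    (fits_rightWord (fun i => (seqC_bounds hθ _).1) (fun i _ _ => seqC_of_lt θ (by omega))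
      fun i _ _ => (seqC_bounds hθ _).2) h (i - s).toNat (by omega)
  rw [lam_shift] at this
  rwa [show s + ((i - s).toNat : ℤ) = i by omega] at this

theorem lam_seqC_le_of_ne_zero {θ : ℕ → ℕ} (hθ : ∀ n, θ n = 1 ∨ θ n = 2) {i : ℤ} (hi : i ≠ 0) :
    lam i (seqC θ) ≤ 3.70969985975024 := by
  have hpos := fun i => (seqC_bounds hθ i).1
  have e : (3.70969985975024 : ℝ) = (370969985975024 : ℕ) / (100000000000000 : ℕ) := by norm_num
  -- For i ≤ -16 the window up to i + 28 ends at 12, the last position where the sequence agrees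
  -- with the periodic one.
  rcases lt_or_ge i (-15) with h | h
  · have := lam_zero_le_of_periodic (a := fun j => seqC θ (i + j)) (fun _ => hpos _) i
      fun j h1 h2 => by
        rw [seqC_of_lt θ (by omega), coreLetter_eq_periodicWord (by omega)]
    rw [lam_shift, add_zero] at this
    linarith
  rcases lt_or_ge i 0 with h0 | h0
  · rw [e]
    exact lam_seqC_le hθ (by norm_num) (-15) 25 35 15 (by norm_num) (by decide +kernel) i
      (by omega) (by push_cast; omega)
  rcases lt_or_ge i 20 with h20 | h20
  · rw [e]
    exact lam_seqC_le hθ (by norm_num) 1 35 19 19 (by norm_num) (by decide +kernel) i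
      (by omega) (by push_cast; omega)
  -- From position 20 on the letters are 1 or 2, and 2 + 4/5 + 4/5 = 36/10 is enough.
  · have key : ∀ x ≤ 2, sumLe 36 10 x (enclose []) (enclose []) = true := by decide
    have := lam_zero_le (a := fun j => seqC θ (i + j)) (l := []) (r := []) (x := seqC θ i)
      (n := 36) (d := 10) (by norm_num) (fun _ => hpos _)
      ⟨fun _ => hpos _, (seqC_bounds hθ _).2, (seqC_bounds hθ _).2, (seqC_bounds hθ _).2⟩
      ⟨by simp [rightPart], hpos i, fun _ => hpos _, (seqC_bounds hθ _).2, (seqC_bounds hθ _).2,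
        (seqC_bounds hθ _).2⟩ (key _ (seqC_le_two hθ h20))
    rw [lam_shift, add_zero] at this
    norm_num at this ⊢
    linarith

theorem lam_zero_seqC_mem {θ : ℕ → ℕ} (hθ : ∀ n, θ n = 1 ∨ θ n = 2) :
    lam 0 (seqC θ) ∈ Set.Ioo (3.70969985975024 : ℝ) 3.70969985975028 := by
  have hpos := fun i => (seqC_bounds hθ i).1
  -- Two letters of θ are included to sharpen the enclosure; all four choices are evaluated.
  set word : ℕ → ℕ → List ℕ := fun x y => [2, 2, 2, 1, 2, 3, 3, 2, 2, 2, 1, 2, 2, 1, 2, 1, 2, 1, 2] ++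
    [x, y] with hword
  have hl : Fits (leftWord coreLetter 60) (leftPart (seqC θ)) :=
    fits_leftWord hpos (fun i _ h => seqC_of_lt θ (by omega)) fun i _ _ => (seqC_bounds hθ _).2
  have hr : Fits (3 :: word (θ 0) (θ 1)) (rightPart (seqC θ)) := by
    refine fits_of_getD _ _ (fun _ => hpos _) (fun k hk => ?_) fun k _ => (seqC_bounds hθ _).2
    have hk' : k < 22 := by simpa [hword] using hk
    rw [rightPart]
    rcases lt_or_ge k 20 with h | h
    · rw [seqC_of_lt θ (by omega)]
      have key : ∀ x ∈ [1, 2], ∀ y ∈ [1, 2], ∀ k < 20, coreLetter (k : ℕ) =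
          (3 :: word x y).getD k 0 := by decide
      exact key _ (by simpa using hθ 0) _ (by simpa using hθ 1) k h
    · rw [seqC_of_ge θ (by omega)]
      obtain rfl | rfl : k = 20 ∨ k = 21 := by omega
      · rfl
      · rfl
  have key : ∀ x ∈ [1, 2], ∀ y ∈ [1, 2],
      sumGe 3709699859750241 1000000000000000 3 (enclose (leftWord coreLetter 60))
        (enclose (word x y)) = true ∧
      sumLe 37096998597502799 10000000000000000 3 (enclose (leftWord coreLetter 60))
        (enclose (word x y)) = true := by decide +kernel
  obtain ⟨h1, h2⟩ := key _ (by simpa using hθ 0) _ (by simpa using hθ 1)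
  have h3 := le_lam_zero (by norm_num) hpos hl hr h1
  have h4 := lam_zero_le (by norm_num) hpos hl hr h2
  push_cast at h3 h4
  norm_num at h3 h4 ⊢
  constructor <;> linarith

/-! ### The set `C` -/

/-- The sequence of letters `1` and `2` that encodes a sequence of truth values. -/
def lettersOf (s : ℕ → Bool) (n : ℕ) : ℕ := if s n then 2 else 1

theorem lettersOf_eq (s : ℕ → Bool) (n : ℕ) : lettersOf s n = 1 ∨ lettersOf s n = 2 := by
  rw [lettersOf]; split_ifs <;> simp

theorem cantorC_eq_range : cantorC = Set.range fun s => lam 0 (seqC (lettersOf s)) := by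
  ext x
  constructor
  · rintro ⟨θ, hθ, rfl⟩
    refine ⟨fun n => decide (θ n = 2), ?_⟩
    have : lettersOf (fun n => decide (θ n = 2)) = θ := by
      funext n
      rcases hθ n with h | h <;> simp [lettersOf, h]
    simp only [this]
  · rintro ⟨s, rfl⟩
    exact ⟨_, lettersOf_eq s, rfl⟩

theorem leftTail_seqC (θ θ' : ℕ → ℕ) : leftTail (seqC θ) 0 = leftTail (seqC θ') 0 := by
  rw [leftTail, leftTail]
  congr 2
  funext k
  rw [seqC_of_lt θ (by omega), seqC_of_lt θ' (by omega)]

theorem injective_lam_seqC : Function.Injective fun s => lam 0 (seqC (lettersOf s)) := by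
  intro s t h
  have hs := fun i => (seqC_bounds (lettersOf_eq s) i).1
  have ht := fun i => (seqC_bounds (lettersOf_eq t) i).1
  simp only [lam_eq_tails hs, lam_eq_tails ht] at h
  rw [leftTail_seqC (lettersOf s) (lettersOf t)] at h
  have h1 := cfValue_injective _ _ (fun _ => hs _) (fun _ => ht _) (add_right_cancel h)
  funext n
  have h2 := congrFun h1 (n + 20)
  rw [seqC_of_ge _ (by omega), seqC_of_ge _ (by omega),
    show (0 + ((n + 20 : ℕ) : ℤ) - 20).toNat = n by omega] at h2
  simp only [lettersOf] at h2
  cases hs' : s n <;> cases ht' : t n <;> simp [hs', ht'] at h2 ⊢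

theorem continuous_lam_seqC : Continuous fun s => lam 0 (seqC (lettersOf s)) := by
  rw [continuous_iff_continuousAt]
  intro s
  refine Metric.tendsto_nhds.2 fun ε hε => ?_
  have h1 : Tendsto (fun n : ℕ => 2 * ((1 : ℝ) / 4) ^ (n / 2)) atTop (𝓝 0) := by
    simpa using tendsto_quarter_pow.const_mul 2
  obtain ⟨N, hN⟩ := (h1.eventually_lt_const hε).exists
  have h2 : ∀ᶠ t : ℕ → Bool in 𝓝 s, ∀ k ∈ Finset.range (N + 1), t k = s k := by
    rw [eventually_all_finset]
    intro k _
    have h2 : IsOpen ((fun t : ℕ → Bool => t k) ⁻¹' {s k}) :=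
      (isOpen_discrete _).preimage (continuous_apply k)
    filter_upwards [h2.mem_nhds rfl] with t ht using ht
  filter_upwards [h2] with t ht
  have hs' := fun i => (seqC_bounds (lettersOf_eq s) i).1
  have ht' := fun i => (seqC_bounds (lettersOf_eq t) i).1
  rw [Real.dist_eq, lam_eq_tails hs', lam_eq_tails ht', leftTail_seqC (lettersOf s) (lettersOf t),
    add_sub_add_right_eq_sub]
  refine (abs_cfValue_sub_le N _ _ (fun _ => ht' _) (fun _ => hs' _) fun k hk => ?_).trans_lt hN
  rcases lt_or_ge k 20 with h | h
  · rw [seqC_of_lt _ (by omega), seqC_of_lt _ (by omega)]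
  · rw [seqC_of_ge _ (by omega), seqC_of_ge _ (by omega), lettersOf, lettersOf,
      ht _ (Finset.mem_range.2 (by omega))]

theorem cantorC_subset_markovSpectrum : cantorC ⊆ markovSpectrum := by
  rintro _ ⟨θ, hθ, rfl⟩
  refine lam_mem_markovSpectrum (fun i => (seqC_bounds hθ i).1) fun i => ?_
  rcases eq_or_ne i 0 with rfl | hi
  · rfl
  · exact (lam_seqC_le_of_ne_zero hθ hi).trans (lam_zero_seqC_mem hθ).1.le

theorem cantorC_subset_Ioo : cantorC ⊆ Set.Ioo (3.70969985975024 : ℝ) 3.70969985975028 := by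
  rintro _ ⟨θ, hθ, rfl⟩
  exact lam_zero_seqC_mem hθ

theorem lagrangeSpectrum_inter_gap :
    lagrangeSpectrum ∩ Set.Ioo (3.70969985968 : ℝ) (3.70969985975033 : ℝ) = ∅ := by
  rw [Set.eq_empty_iff_forall_notMem]
  rintro ℓ ⟨hℓ, h1, h2⟩
  obtain ⟨b, hb, hlt, hgt⟩ := exists_seq_of_mem_lagrangeSpectrum hℓ
  obtain ⟨N, hN⟩ := hlt _ h2
  exact false_of_lam_in_gap hb hN (hgt _ (by norm_num) h1)

theorem theoremA :
    -- `C` is a Cantor set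
    Nonempty (cantorC ≃ₜ (ℕ → Bool)) ∧
    -- `C` is contained in `M \ L`
    cantorC ⊆ markovSpectrum \ lagrangeSpectrum ∧
    -- `C` is contained in the intersection of `M` with a small interval
    cantorC ⊆ markovSpectrum ∩ Set.Ioo (3.70969985975024 : ℝ) (3.70969985975028 : ℝ) ∧
    -- a larger interval contains no element of `L`
    lagrangeSpectrum ∩ Set.Ioo (3.70969985968 : ℝ) (3.70969985975033 : ℝ) = ∅ := by
  have hgap := Set.eq_empty_iff_forall_notMem.1 lagrangeSpectrum_inter_gap
  refine ⟨⟨?_⟩, fun x hx => ⟨cantorC_subset_markovSpectrum hx, fun hL => hgap x ⟨hL, ?_⟩⟩,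
    fun x hx => ⟨cantorC_subset_markovSpectrum hx, cantorC_subset_Ioo hx⟩,
    lagrangeSpectrum_inter_gap⟩
  · rw [cantorC_eq_range]
    -- A continuous injection from a compact space into a Hausdorff space is an embedding.
    exact (continuous_lam_seqC.isClosedEmbedding injective_lam_seqC).isEmbedding.toHomeomorph.symm
  · have := cantorC_subset_Ioo hx
    exact ⟨lt_trans (by norm_num) this.1, lt_trans this.2 (by norm_num)⟩
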